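/- **Theorem 2 (Convergence rate).** Let $p,q\ge 1$, and let $\theta=[a_1,\dots,a_p,b_1,\dots,b_q]^T\in\mathbb R^{p+q}$ with $a_p\neq 0$ be such that the polynomials $1-zA(z)=1-a_1z-\dots-a_pz^p$ and $B(z)=b_1+b_2z+\dots+b_qz^{q-1}$ have no common complex root. Consider the model $$y_k=\sum_{i=1}^p a_iy_{k-i}+\sum_{j=1}^q b_ju_{k-j+1}=\phi_k^T\theta,\qquad z_k=y_k+d_k,\qquad s_k=I_{\{z_k\le C\}},\qquad k\ge 1,$$ where $\phi_k=[y_{k-1},\dots,y_{k-p},u_k,\dots,u_{k-q+1}]^T$, $C\in\mathbb R$ is a fixed threshold, and the input $(u_k)$ and the initial values of $y$ are deterministic. Norms are Euclidean. Assume: 1. For a given $0<h<1$, let $\Omega_h$ be the set of parameters in $\mathbb R^{p+q}$ for which all complex roots of $1-zA(z)$ lie outside the unit circle and have modulus greater than $1/h$. Then $\theta\in\Theta\subseteq\Omega_h$, where $\Theta$ is convex and compact. Put $\bar B=\sup_{v\in\Theta}\|v\|$. 2. $d_1,d_2,\dots$ are i.i.d. with mean zero, and their distribution function $F$ has a continuous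 derivative $f=F'$ which vanishes nowhere. 3. $(u_k)_{k\ge1}$ is bounded, and there are $\delta_1>0$ and an integer $m>0$ with $\frac1m\sum_{i=k}^{k+m-1}U_iU_i^T\ge\delta_1 I_{p+q}$ for all $k\ge1$, where $U_i=[u_i,\dots,u_{i-p-q+1}]^T$. Let $\Pi_\Theta$ be the Euclidean projection onto $\Theta$, and let the estimates $\hat\theta_k$ and the predictions $\hat y_k$ be given, from deterministic initial values, for $k\ge1$ by $$\hat\theta_k=\Pi_\Theta\Big\{\hat\theta_{k-1}+\frac{\gamma}{k}\varphi_k\big(F(C-\varphi_k^T\hat\theta_{k-1})-s_k\big)\Big\},\qquad \varphi_k=[\hat y_{k-1},\dots,\hat y_{k-p},u_k,\dots,u_{k-q+1}]^T,\qquad \hat y_k=\varphi_k^T\hat\theta_k .$$ Let $g(h)=\sum_{i=1}^p\big(\binom pi h^i\big)^2$. Let $A$ be the $p\times p$ companion matrix with first row $(a_1,\dots,a_p)$, ones on the subdiagonal and zeros elsewhere, with spectral radius $\rho(A)$; let $\varepsilon>0$, $M=\sqrt p\,(1+2/\varepsilon)^{p-1}$ and $\rho(A)+\varepsilon\|A\|\le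 h_1<1$. Let $M_1,M_2>0$ be constants with $\|\phi_k\|\le M_1$ and, almost surely, $\|\varphi_k\|\le M_2$ for all $k\ge1$. Let the integer $N\ge1$ and $\delta>0$ satisfy $\frac1N\sum_{i=k}^{k+N-1}\phi_i\phi_i^T\ge\delta I_{p+q}$ for all $k\ge1$. Let $f_M$ and $f_m$ be the maximum and the minimum of $f$ on $[C-\bar BM_2,C+\bar BM_2]\cup[C-\bar BM_1,C+\bar BM_1]$. Suppose that $$D:=f_m\delta-\frac{f_M\sqrt{g(h)}\,M_2M}{1-h_1}\,(M_2+2M_1)>0\qquad\text{and}\qquad \gamma>\frac1{2D}.$$ Then the mean-square error of the estimator satisfies $$E\|\hat\theta_k-\theta\|^2=O(1/k)\qquad(k\to\infty).$$ -/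

import Mathlib

open MeasureTheory ProbabilityTheory Filter Asymptotics

noncomputable section

namespace ARMA

/-- The parameter space `ℝ^(p+q)` with the Euclidean norm.  A vector `v` is read as
`[a₁, …, a_p, b₁, …, b_q]`, with `a_{i+1} = v (Sum.inl i)` and `b_{j+1} = v (Sum.inr j)`. -/
abbrev Param (p q : ℕ) : Type := EuclideanSpace ℝ (Fin p ⊕ Fin q)

/-- The polynomial `1 - z A(z) = 1 - a₁ z - ⋯ - a_p z^p`. -/
def arPoly {p q : ℕ} (v : Param p q) : Polynomial ℝ :=
  1 - ∑ i : Fin p, Polynomial.C (v (Sum.inl i)) * Polynomial.X ^ ((i : ℕ) + 1)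

/-- The polynomial `B(z) = b₁ + b₂ z + ⋯ + b_q z^(q-1)`. -/
def inPoly {p q : ℕ} (v : Param p q) : Polynomial ℝ :=
  ∑ j : Fin q, Polynomial.C (v (Sum.inr j)) * Polynomial.X ^ (j : ℕ)

/-- The set of the parameters for which all complex roots of `1 - z A(z)` lie outside the
unit circle and have modulus greater than `1 / h`. -/
def causalSet (p q : ℕ) (h : ℝ) : Set (Param p q) :=
  {v | ∀ z : ℂ, Polynomial.aeval z (arPoly v) = 0 → 1 < ‖z‖ ∧ 1 / h < ‖z‖}

/-- The regressor `[y_{k-1}, …, y_{k-p}, u_k, …, u_{k-q+1}]`. -/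
def regressor (p q : ℕ) (y u : ℤ → ℝ) (k : ℤ) : Param p q :=
  WithLp.toLp 2 (Sum.elim (fun i : Fin p => y (k - 1 - (i : ℕ)))
    (fun j : Fin q => u (k - (j : ℕ))))

/-- The input window `U_k = [u_k, u_{k-1}, …, u_{k-n+1}]`. -/
def inputWindow (n : ℕ) (u : ℤ → ℝ) (k : ℤ) : EuclideanSpace ℝ (Fin n) :=
  WithLp.toLp 2 (fun i : Fin n => u (k - (i : ℕ)))

/-- `(1/N) ∑_{i=k}^{k+N-1} ψ_i ψ_iᵀ ≥ δ I` for all `k = 1, 2, …`, in the Loewner order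
(written with the quadratic forms of the two sides). -/
def Excites {ι : Type*} [Fintype ι] (ψ : ℤ → EuclideanSpace ℝ ι) (N : ℕ) (δ : ℝ) : Prop :=
  ∀ k : ℕ, 1 ≤ k → ∀ x : EuclideanSpace ℝ ι,
    δ * ‖x‖ ^ 2 ≤ (1 / (N : ℝ)) * ∑ i ∈ Finset.range N, (inner ℝ (ψ ((k : ℤ) + (i : ℤ))) x) ^ 2

/-- The input is bounded for `k = 1, 2, …` and persistently exciting of order `p + q`. -/
def PersistentInput (p q : ℕ) (u : ℤ → ℝ) : Prop :=
  (∃ K : ℝ, ∀ k : ℕ, 1 ≤ k → |u k| ≤ K) ∧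
    ∃ δ₁ : ℝ, 0 < δ₁ ∧ ∃ m : ℕ, 0 < m ∧ Excites (inputWindow (p + q) u) m δ₁

/-- `y` is an output of the model with parameter `θ` and input `u`:
`y_k = a₁ y_{k-1} + ⋯ + a_p y_{k-p} + b₁ u_k + ⋯ + b_q u_{k-q+1}` for `k = 1, 2, …`.
The values of `y` at times `≤ 0` are the initial conditions. -/
def IsOutput {p q : ℕ} (θ : Param p q) (u y : ℤ → ℝ) : Prop :=
  ∀ k : ℕ, 1 ≤ k →
    y k = ∑ i : Fin p, θ (Sum.inl i) * y ((k : ℤ) - 1 - (i : ℕ)) +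
      ∑ j : Fin q, θ (Sum.inr j) * u ((k : ℤ) - (j : ℕ))

/-- The binary observation of `z` with threshold `C`: it is `1` if `z ≤ C` and `0` if `z > C`. -/
def binaryObs (C z : ℝ) : ℝ := if z ≤ C then 1 else 0

/-- The noise `d₁, d₂, …` (the variable `d 0` plays no role) is independent and identically
distributed with law `ν` and mean zero; the distribution function of `ν` has the continuous
and nowhere vanishing derivative `f`. -/
structure IsNoise {Ω : Type*} [MeasurableSpace Ω] (μ : Measure Ω) (d : ℕ → Ω → ℝ)
    (ν : Measure ℝ) (f : ℝ → ℝ) : Prop where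
  hasLaw : ∀ k : ℕ, 1 ≤ k → HasLaw (d k) ν μ
  indep : iIndepFun (fun k : ℕ => d (k + 1)) μ
  integrable : ∀ k : ℕ, 1 ≤ k → Integrable (d k) μ
  mean_zero : ∀ k : ℕ, 1 ≤ k → ∫ ω, d k ω ∂μ = 0
  hasDerivAt_cdf : ∀ x : ℝ, HasDerivAt (fun t => cdf ν t) (f x) x
  continuous_density : Continuous f
  density_ne_zero : ∀ x : ℝ, f x ≠ 0

/-- `w = Π_Λ(x)`: the point `w` minimizes the distance to `x` over `Λ`. For a nonempty, convex
and compact `Λ` there is exactly one such point. -/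
def IsProjection {E : Type*} [NormedAddCommGroup E] (Λ : Set E) (x w : E) : Prop :=
  w ∈ Λ ∧ ∀ l ∈ Λ, ‖x - w‖ ≤ ‖x - l‖

/-- One trajectory of the identification algorithm with step size `γ`, threshold `C`, noise
distribution function `F`, projection set `Θ`, input `u` and binary observations `s`. For
`k = 1, 2, …`, with `φ̂_k = [ŷ_{k-1}, …, ŷ_{k-p}, u_k, …, u_{k-q+1}]`,
`θ̂_k = Π_Θ (θ̂_{k-1} + (γ/k) φ̂_k (F (C - φ̂_kᵀ θ̂_{k-1}) - s_k))` and `ŷ_k = φ̂_kᵀ θ̂_k`.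
The vector `θ̂_0` and the values of `ŷ` at times `≤ 0` are the initial conditions. -/
structure IsTrajectory {p q : ℕ} (γ C : ℝ) (F : ℝ → ℝ) (Θ : Set (Param p q)) (u : ℤ → ℝ)
    (s : ℕ → ℝ) (θhat : ℕ → Param p q) (yhat : ℤ → ℝ) : Prop where
  estimate : ∀ k : ℕ, 1 ≤ k →
    IsProjection Θ
      (θhat (k - 1) + ((γ / (k : ℝ)) *
        (F (C - inner ℝ (regressor p q yhat u k) (θhat (k - 1))) - s k)) •
          regressor p q yhat u k)
      (θhat k)
  prediction : ∀ k : ℕ, 1 ≤ k → yhat k = inner ℝ (regressor p q yhat u k) (θhat k)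

/-- The companion matrix with first row `(a₁, …, a_p)` and ones below the diagonal. -/
def companion {p q : ℕ} (v : Param p q) : Matrix (Fin p) (Fin p) ℝ :=
  Matrix.of fun i j =>
    if (i : ℕ) = 0 then v (Sum.inl j) else if (i : ℕ) = (j : ℕ) + 1 then 1 else 0

/-- The spectral radius of a real matrix (the largest modulus of its complex eigenvalues). -/
def specRadius {n : ℕ} (A : Matrix (Fin n) (Fin n) ℝ) : ℝ :=
  (spectralRadius ℂ (A.map (algebraMap ℝ ℂ))).toReal

/-- The operator norm of a matrix for the Euclidean norm of vectors. -/
def opNorm {n : ℕ} (A : Matrix (Fin n) (Fin n) ℝ) : ℝ :=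
  ‖Matrix.toEuclideanCLM (n := Fin n) (𝕜 := ℝ) A‖

/-- `g(h) = ∑_{i=1}^p (binom(p,i) h^i)^2 = p² h² + ⋯ + h^(2p)`. -/
def gBound (p : ℕ) (h : ℝ) : ℝ :=
  ∑ i ∈ Finset.Icc 1 p, ((p.choose i : ℝ) * h ^ i) ^ 2

/-- `M = √p (1 + 2/ε)^(p-1)`. -/
def powConst (p : ℕ) (ε : ℝ) : ℝ := Real.sqrt p * (1 + 2 / ε) ^ (p - 1)

/-- `f_m δ - f_M √g(h) M₂ M (M₂ + 2 M₁) / (1 - h₁)`. -/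
def margin (fm fM δ g M M₁ M₂ h₁ : ℝ) : ℝ :=
  fm * δ - fM * Real.sqrt g * M₂ * M / (1 - h₁) * (M₂ + 2 * M₁)

end ARMA

end

/-! Write `x_k = θ̂_k - θ`. Since the projection is nonexpansive and fixes `θ`, one step gives
`‖x_{k+1}‖² ≤ ‖x_k‖² + 2γ/(k+1) · φ̂ᵀx_k · (F(C - φ̂ᵀθ̂_k) - s_{k+1}) + O(1/k²)` with `φ̂ =
φ̂_{k+1}` (`IsTrajectory.norm_sq_succ_le`). Split the bracket at `F(C - y_{k+1})`. The part `F(C -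
y_{k+1}) - s_{k+1}` is centered and independent of the past, so it disappears in expectation
(`IsNoise.integral_mul_obs_eq_zero`). By the mean value theorem the other part contributes at most
`-f_m (φᵀx_k)²`, with `φ` the true regressor, plus an error linear in `φ̂ - φ`
(`inner_mul_correction_le`).

The error `φ̂ - φ` consists of past prediction errors. These obey the recursion of the companion
matrix, driven by `φ̂ᵀx` (`IsTrajectory.lagVector_succ`). The powers of this matrix are at most `M
h₁^k` (`norm_toEuclideanCLM_pow_le`) and `‖x_k‖` changes by `O(1/k)` per step, so the lag vector has
norm at most `M M₂/(1-h₁) ‖x_k‖ + O(1/k)` (`exists_bound_of_driven_recursion`). The factor `√g(h)`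
bounds the autoregressive coefficients of every point of `Θ`, by Vieta (`sum_sq_le_gBound`). The
error thus costs exactly the subtracted term of `D`.

A single regressor sees only one direction. Over a window of length `N`, however, `x` is nearly
constant, and excitation turns the sum of `(φᵀx)²` into `Nδ‖x‖²` (`exists_window_bound`). In
expectation, `v_n = E‖x_n‖²` satisfies `v_{n+N} ≤ (1 - 2γDN/n) v_n + c/n²`. As `2γD > 1`, Chung's
lemma gives `O(1/n)` (`isBigO_of_chung_recursion`). All pathwise constants are chosen before the
trajectory, so they do not depend on the sample point. -/

open MeasureTheory ProbabilityTheory Filter Asymptotics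

noncomputable section

namespace ARMA

/-! ### Geometric decay of matrix powers with explicit constants. -/

section PowerBound

open Polynomial

/-- Powers of an element annihilated by `∏ (X - l i)` are bounded combinations of the partial
products `∏_{i < j} (X - l i)`. -/
theorem exists_pow_eq_sum_newton {R : Type*} [Ring R] [Algebra ℂ R] (a : R) (p : ℕ) (hp : 0 < p)
    (l : ℕ → ℂ) (ρ t h : ℝ) (ht : 0 ≤ t) (hl : ∀ i < p, ‖l i‖ ≤ ρ) (hρ : 0 ≤ ρ) (hh : ρ + t ≤ h)
    (ha : aeval a (∏ i ∈ Finset.range p, (X - C (l i))) = 0) (k : ℕ) :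
    ∃ c : ℕ → ℂ, (∀ j < p, ‖c j‖ * t ^ j ≤ h ^ k) ∧
      a ^ k = ∑ j ∈ Finset.range p, c j • aeval a (∏ i ∈ Finset.range j, (X - C (l i))) := by
  have hh0 : 0 ≤ h := by linarith
  induction k with
  | zero =>
    refine ⟨fun j => if j = 0 then 1 else 0, fun j _ => ?_, ?_⟩
    · by_cases hj : j = 0 <;> simp [hj]
    · simp [ite_smul, Finset.sum_ite_eq', hp]
  | succ k ih =>
    obtain ⟨c, hc, hak⟩ := ih
    set P : ℕ → R := fun j => aeval a (∏ i ∈ Finset.range j, (X - C (l i))) with hP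
    have hPs : ∀ j, P j * a = P (j + 1) + l j • P j := by
      intro j
      simp only [hP, Finset.prod_range_succ, map_mul, map_sub, aeval_X, aeval_C]
      rw [mul_sub, Algebra.smul_def, ← Algebra.commutes (l j)]
      abel
    -- Multiplication by `a` keeps `l j` times the coefficient and shifts a copy up by one. In the
    -- weight `t ^ j` the shift costs one factor `t`, so the bound grows by `ρ + t ≤ h`.
    refine ⟨fun j => l j * c j + if j = 0 then 0 else c (j - 1), fun j hj => ?_, ?_⟩
    · have h1 : ‖l j * c j‖ * t ^ j ≤ ρ * h ^ k := by
        rw [norm_mul, mul_assoc]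
        exact mul_le_mul (hl j hj) (hc j hj) (by positivity) hρ
      rcases j with _ | j
      · simp only [if_true, add_zero]
        refine h1.trans ?_
        rw [pow_succ']
        exact mul_le_mul_of_nonneg_right (by linarith) (by positivity)
      · simp only [Nat.add_one_ne_zero, if_false, Nat.add_sub_cancel]
        have h2 : ‖c j‖ * t ^ (j + 1) ≤ t * h ^ k := by
          have := mul_le_mul_of_nonneg_left (hc j (by omega)) ht
          calc _ = t * (‖c j‖ * t ^ j) := by ring
            _ ≤ _ := this
        calc ‖l (j + 1) * c (j + 1) + c j‖ * t ^ (j + 1)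
            ≤ (‖l (j + 1) * c (j + 1)‖ + ‖c j‖) * t ^ (j + 1) := by
              gcongr; exact norm_add_le _ _
          _ ≤ ρ * h ^ k + t * h ^ k := by rw [add_mul]; exact add_le_add h1 h2
          _ = (ρ + t) * h ^ k := by ring
          _ ≤ h ^ (k + 1) := by
              rw [pow_succ']; exact mul_le_mul_of_nonneg_right hh (by positivity)
    · obtain ⟨r, rfl⟩ : ∃ r, p = r + 1 := ⟨p - 1, by omega⟩
      rw [pow_succ, hak]
      change (∑ j ∈ Finset.range (r + 1), c j • P j) * a = ∑ j ∈ Finset.range (r + 1),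
        (l j * c j + if j = 0 then 0 else c (j - 1)) • P j
      rw [Finset.sum_mul]
      simp only [smul_mul_assoc, hPs, smul_add, add_smul, Finset.sum_add_distrib]
      rw [add_comm]
      congr 1
      · refine Finset.sum_congr rfl fun j _ => ?_
        rw [smul_smul, mul_comm]
      -- The shift would create a term in the full product `P (r + 1)`, which annihilates `a`.
      · rw [Finset.sum_range_succ, Finset.sum_range_succ']
        simp [show P (r + 1) = 0 from ha]

/-- A power bound for an element of a normed algebra annihilated by a split polynomial. -/
theorem norm_pow_le_of_aeval_eq_zero {R : Type*} [NormedRing R] [NormedAlgebra ℂ R]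
    [NormOneClass R] (a : R) (p : ℕ) (hp : 0 < p) (l : ℕ → ℂ) (ρ ε h : ℝ) (hε : 0 < ε)
    (hl : ∀ i < p, ‖l i‖ ≤ ρ) (hla : ∀ i < p, ‖l i‖ ≤ ‖a‖) (hρ : 0 ≤ ρ) (hh : ρ + ε * ‖a‖ ≤ h)
    (ha : aeval a (∏ i ∈ Finset.range p, (X - C (l i))) = 0) (k : ℕ) :
    ‖a ^ k‖ ≤ (1 + 2 / ε) ^ (p - 1) * h ^ k := by
  obtain ⟨c, hc, hak⟩ := exists_pow_eq_sum_newton a p hp l ρ (ε * ‖a‖) h (by positivity) hl hρ hh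
    ha k
  have hh0 : 0 ≤ h := le_trans (by positivity) hh
  have hP : ∀ j ≤ p, ‖aeval a (∏ i ∈ Finset.range j, (X - C (l i)))‖ ≤ (2 * ‖a‖) ^ j := by
    intro j
    induction j with
    | zero => simp
    | succ j ih =>
      intro hj
      rw [Finset.prod_range_succ, map_mul, pow_succ]
      refine (norm_mul_le _ _).trans (mul_le_mul (ih (by omega)) ?_ (norm_nonneg _) (by positivity))
      simp only [map_sub, aeval_X, aeval_C]
      refine (norm_sub_le _ _).trans ?_
      rw [norm_algebraMap']
      linarith [hla j (by omega)]
  rw [hak]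
  calc ‖∑ j ∈ Finset.range p, c j • aeval a (∏ i ∈ Finset.range j, (X - C (l i)))‖
      ≤ ∑ j ∈ Finset.range p, ‖c j‖ * (2 * ‖a‖) ^ j := by
        refine norm_sum_le_of_le _ fun j hj => ?_
        rw [norm_smul]
        gcongr
        exact hP j (Finset.mem_range.1 hj).le
    -- The binomial coefficients, all at least `1`, are inserted so that the geometric sum becomes
    -- the expansion of `(1 + 2 / ε) ^ (p - 1)`.
    _ ≤ ∑ j ∈ Finset.range p, (2 / ε) ^ j * 1 ^ (p - 1 - j) * ((p - 1).choose j) * h ^ k := by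
        refine Finset.sum_le_sum fun j hj => ?_
        have hj' := Finset.mem_range.1 hj
        have h1 : (2 * ‖a‖) ^ j = (2 / ε) ^ j * (ε * ‖a‖) ^ j := by
          rw [← mul_pow]; congr 1; field_simp
        have h2 : (1 : ℝ) ≤ (p - 1).choose j := by
          exact_mod_cast Nat.choose_pos (by omega)
        calc ‖c j‖ * (2 * ‖a‖) ^ j = (2 / ε) ^ j * (‖c j‖ * (ε * ‖a‖) ^ j) := by rw [h1]; ring
          _ ≤ (2 / ε) ^ j * h ^ k := by gcongr; exact hc j hj'
          _ ≤ (2 / ε) ^ j * h ^ k * (p - 1).choose j :=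
              le_mul_of_one_le_right (by positivity) h2
          _ = _ := by ring
    _ = (1 + 2 / ε) ^ (p - 1) * h ^ k := by
        rw [← Finset.sum_mul, add_comm (1 : ℝ), add_pow, Nat.sub_add_cancel hp]

theorem exists_prod_X_sub_C_eq_charpoly {p : ℕ} (A : Matrix (Fin p) (Fin p) ℂ) :
    ∃ l : ℕ → ℂ, (∀ i < p, l i ∈ spectrum ℂ A) ∧
      A.charpoly = ∏ i ∈ Finset.range p, (X - C (l i)) := by
  have hs := IsAlgClosed.splits A.charpoly
  have hcard : A.charpoly.roots.toList.length = p := by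
    rw [Multiset.length_toList, ← hs.natDegree_eq_card_roots, A.charpoly_natDegree_eq_dim]
    simp
  have hprod := hs.eq_prod_roots_of_monic A.charpoly_monic
  set L := A.charpoly.roots.toList with hL
  refine ⟨fun i => L.getD i 0, fun i hi => ?_, ?_⟩
  · have hi' : i < L.length := by omega
    rw [Matrix.mem_spectrum_iff_isRoot_charpoly]
    have : L.getD i 0 ∈ A.charpoly.roots := by
      rw [List.getD_eq_getElem _ _ hi', ← Multiset.mem_toList]
      exact List.getElem_mem _
    exact isRoot_of_mem_roots this
  · conv_lhs => rw [hprod]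
    rw [← Multiset.coe_toList A.charpoly.roots, ← hL, Multiset.map_coe, Multiset.prod_coe,
      ← Fin.prod_univ_getElem, Finset.prod_range]
    have hlen : (L.map fun a => X - C a).length = p := by simpa using hcard
    refine Fintype.prod_equiv (finCongr hlen) _ _ fun i => ?_
    have hi : (i : ℕ) < L.length := by simpa using i.2
    simp [List.getElem?_eq_getElem hi]

-- A real matrix acts separately on real and imaginary parts, and the squared norms of the two parts
-- add up.
open scoped Matrix.Norms.L2Operator in
theorem norm_map_algebraMap_le {p : ℕ} (A : Matrix (Fin p) (Fin p) ℝ) :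
    ‖A.map (algebraMap ℝ ℂ)‖ ≤ opNorm A := by
  rw [Matrix.l2_opNorm_def]
  refine ContinuousLinearMap.opNorm_le_bound _ (norm_nonneg _) fun x => ?_
  have hre : ∀ v : EuclideanSpace ℂ (Fin p), ‖v‖ ^ 2 =
      ‖(WithLp.toLp 2 fun i => (v i).re : EuclideanSpace ℝ (Fin p))‖ ^ 2 +
      ‖(WithLp.toLp 2 fun i => (v i).im : EuclideanSpace ℝ (Fin p))‖ ^ 2 := by
    intro v
    simp only [EuclideanSpace.norm_sq_eq, ← Finset.sum_add_distrib]
    refine Finset.sum_congr rfl fun i _ => ?_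
    rw [Complex.sq_norm, Complex.normSq_apply]
    simp only [Real.norm_eq_abs, sq_abs]
    ring
  set xr : EuclideanSpace ℝ (Fin p) := WithLp.toLp 2 fun i => (x i).re
  set xi : EuclideanSpace ℝ (Fin p) := WithLp.toLp 2 fun i => (x i).im
  refine le_of_sq_le_sq ?_ (mul_nonneg (norm_nonneg _) (norm_nonneg _))
  have key : ∀ w : EuclideanSpace ℝ (Fin p),
      ‖(Matrix.toEuclideanCLM (n := Fin p) (𝕜 := ℝ) A) w‖ ^ 2 ≤ opNorm A ^ 2 * ‖w‖ ^ 2 := by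
    intro w
    rw [← mul_pow]
    exact pow_le_pow_left₀ (norm_nonneg _) (ContinuousLinearMap.le_opNorm _ _) 2
  rw [mul_pow, hre x, hre, mul_add]
  refine add_le_add (le_trans (le_of_eq ?_) (key xr)) (le_trans (le_of_eq ?_) (key xi))
  · congr 2
    ext i
    simp [Matrix.mulVec, dotProduct, xr]
  · congr 2
    ext i
    simp [Matrix.mulVec, dotProduct, xi]

/-- The spectrum of a matrix is finite, so the extended spectral radius is finite and `toReal` loses
nothing. -/
theorem norm_le_specRadius {p : ℕ} (A : Matrix (Fin p) (Fin p) ℝ) {z : ℂ}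
    (hz : z ∈ spectrum ℂ (A.map (algebraMap ℝ ℂ))) : ‖z‖ ≤ specRadius A := by
  have hle : (‖z‖₊ : ENNReal) ≤ spectralRadius ℂ (A.map (algebraMap ℝ ℂ)) :=
    le_iSup₂ (f := fun k (_ : k ∈ spectrum ℂ (A.map (algebraMap ℝ ℂ))) => (‖k‖₊ : ENNReal)) z hz
  have hfin : spectralRadius ℂ (A.map (algebraMap ℝ ℂ)) ≠ ⊤ := by
    obtain ⟨K, hK⟩ := ((Matrix.finite_spectrum (A.map (algebraMap ℝ ℂ))).image
      fun w => ‖w‖₊).bddAbove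
    refine ne_top_of_le_ne_top (ENNReal.coe_ne_top (r := K)) (iSup₂_le fun w hw => ?_)
    exact ENNReal.coe_le_coe.2 (hK ⟨w, hw, rfl⟩)
  have := ENNReal.toReal_mono hfin hle
  simpa [specRadius] using this

-- Over `ℂ` the characteristic polynomial splits and annihilates the matrix by Cayley–Hamilton, so
-- the Newton-product bound applies; real vectors embed isometrically into complex ones. The factor
-- `√p` in `powConst` is slack here.
open scoped Matrix.Norms.L2Operator in
theorem norm_toEuclideanCLM_pow_le {p : ℕ} (hp : 0 < p) (A : Matrix (Fin p) (Fin p) ℝ)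
    (ε h : ℝ) (hε : 0 < ε) (hh : specRadius A + ε * opNorm A ≤ h) (k : ℕ) :
    ‖Matrix.toEuclideanCLM (n := Fin p) (𝕜 := ℝ) A ^ k‖ ≤ powConst p ε * h ^ k := by
  have : Nonempty (Fin p) := ⟨⟨0, hp⟩⟩
  set Ac := A.map (algebraMap ℝ ℂ) with hAc
  have hh0 : 0 ≤ h := le_trans (add_nonneg ENNReal.toReal_nonneg
    (mul_nonneg hε.le (norm_nonneg _))) hh
  have hc : ‖Ac ^ k‖ ≤ (1 + 2 / ε) ^ (p - 1) * h ^ k := by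
    obtain ⟨l, hl, hchar⟩ := exists_prod_X_sub_C_eq_charpoly Ac
    refine norm_pow_le_of_aeval_eq_zero Ac p hp l (specRadius A) ε h hε
      (fun i hi => norm_le_specRadius A (hl i hi))
      (fun i hi => spectrum.norm_le_norm_of_mem (hl i hi)) ENNReal.toReal_nonneg ?_ ?_ k
    · exact le_trans (by gcongr; exact norm_map_algebraMap_le A) hh
    · rw [← hchar, Matrix.aeval_self_charpoly]
  have hr : ‖Matrix.toEuclideanCLM (n := Fin p) (𝕜 := ℝ) A ^ k‖ ≤ ‖Ac ^ k‖ := by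
    refine ContinuousLinearMap.opNorm_le_bound _ (norm_nonneg _) fun x => ?_
    have hcoe : ∀ v : EuclideanSpace ℝ (Fin p),
        ‖(WithLp.toLp 2 fun i => (v i : ℂ) : EuclideanSpace ℂ (Fin p))‖ = ‖v‖ := by
      intro v
      simp [EuclideanSpace.norm_eq]
    have := Matrix.l2_opNorm_mulVec (Ac ^ k) (WithLp.toLp 2 fun i => (x i : ℂ))
    rw [hcoe x] at this
    refine le_trans (le_of_eq ?_) this
    rw [← map_pow, ← hcoe]
    congr 1
    have hpow : Ac ^ k = (A ^ k).map (algebraMap ℝ ℂ) := by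
      rw [hAc, ← RingHom.mapMatrix_apply, ← RingHom.mapMatrix_apply, map_pow]
    rw [hpow]
    ext i
    rw [Matrix.ofLp_toEuclideanCLM]
    simp [Matrix.mulVec, dotProduct]
  have hs : (1 : ℝ) ≤ Real.sqrt p := Real.one_le_sqrt.2 (by exact_mod_cast hp)
  refine (hr.trans hc).trans ?_
  rw [powConst]
  have h3 : 0 ≤ (1 + 2 / ε) ^ (p - 1) * h ^ k := by positivity
  nlinarith [mul_le_mul_of_nonneg_right hs h3]

end PowerBound

/-! ### Autoregressive coefficients of stable models and the regressor error. -/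

section CoefficientBound

open Polynomial

/-- The reciprocal polynomial `z^p - a₁ z^(p-1) - ⋯ - a_p` is monic with all roots of modulus at
most `h`, so Vieta's formulas bound its coefficients. Its root `0`, possible when `a_p` vanishes,
has no inverse and is treated apart. -/
theorem abs_coeff_le_of_mem_causalSet {p q : ℕ} {h : ℝ} (hh : 0 < h) {v : Param p q}
    (hv : v ∈ causalSet p q h) (i : Fin p) :
    |v (Sum.inl i)| ≤ (p.choose (i + 1) : ℝ) * h ^ ((i : ℕ) + 1) := by
  set S : ℝ[X] := ∑ j : Fin p, C (-v (Sum.inl j)) * X ^ (p - 1 - (j : ℕ)) with hS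
  have hp : 0 < p := i.pos
  have hSdeg : S.degree < (p : ℕ) := by
    refine (degree_sum_le _ _).trans_lt ?_
    rw [Finset.sup_lt_iff (by exact_mod_cast WithBot.bot_lt_coe p)]
    intro j _
    refine (degree_C_mul_X_pow_le _ _).trans_lt ?_
    exact_mod_cast (by omega : p - 1 - (j : ℕ) < p)
  have hmonic : (X ^ p + S).Monic := monic_X_pow_add hSdeg
  have hdeg : (X ^ p + S).natDegree = p := by
    rw [natDegree_add_eq_left_of_degree_lt (by rw [degree_X_pow]; exact hSdeg), natDegree_X_pow]
  have hroots : ∀ z ∈ ((X ^ p + S).map (algebraMap ℝ ℂ)).roots, ‖z‖ ≤ h := by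
    intro z hz
    have hz0 : aeval z (X ^ p + S) = 0 := by
      have := isRoot_of_mem_roots hz
      rwa [IsRoot.def, eval_map_algebraMap] at this
    by_cases hzz : z = 0
    · simp [hzz, hh.le]
    have hinv : aeval z⁻¹ (arPoly v) = 0 := by
      have : aeval z⁻¹ (arPoly v) = (z⁻¹) ^ p * aeval z (X ^ p + S) := by
        simp only [arPoly, hS, map_add, map_sub, map_one, map_sum, map_mul, map_pow, aeval_X,
          aeval_C, mul_add, Finset.mul_sum]
        rw [← mul_pow, inv_mul_cancel₀ hzz, one_pow, sub_eq_add_neg, ← Finset.sum_neg_distrib]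
        congr 1
        refine Finset.sum_congr rfl fun j _ => ?_
        have hj : (z⁻¹) ^ p = (z⁻¹) ^ (p - 1 - (j : ℕ)) * (z⁻¹) ^ ((j : ℕ) + 1) := by
          rw [← pow_add]; congr 1; omega
        have : (z⁻¹) ^ p * z ^ (p - 1 - (j : ℕ)) = (z⁻¹) ^ ((j : ℕ) + 1) := by
          rw [hj, mul_right_comm, ← mul_pow, inv_mul_cancel₀ hzz, one_pow,
            one_mul]
        rw [mul_left_comm, this, map_neg, neg_mul]
      rw [this, hz0, mul_zero]
    have h1 := (hv _ hinv).2
    rw [norm_inv, one_div] at h1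
    exact ((inv_lt_inv₀ hh (norm_pos_iff.2 hzz)).1 h1).le
  have key := coeff_le_of_roots_le (f := algebraMap ℝ ℂ) (p - 1 - (i : ℕ)) hmonic
    (IsAlgClosed.splits _) hroots
  rw [hdeg, coeff_map, norm_algebraMap', Real.norm_eq_abs] at key
  have hc : (X ^ p + S).coeff (p - 1 - (i : ℕ)) = -v (Sum.inl i) := by
    rw [coeff_add, coeff_X_pow, if_neg (by omega), zero_add, hS, finsetSum_coeff]
    simp only [coeff_C_mul, coeff_X_pow]
    rw [Finset.sum_eq_single i]
    · simp
    · intro j _ hji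
      have : (j : ℕ) ≠ i := fun e => hji (Fin.ext e)
      rw [if_neg (by omega), mul_zero]
    · simp
  rw [hc, abs_neg, show p - (p - 1 - (i : ℕ)) = i + 1 by omega,
    Nat.choose_symm_of_eq_add (show p = (p - 1 - (i : ℕ)) + (i + 1) by omega), mul_comm] at key
  exact key

theorem sum_sq_le_gBound {p q : ℕ} {h : ℝ} (hh : 0 < h) {v : Param p q}
    (hv : v ∈ causalSet p q h) : ∑ i : Fin p, v (Sum.inl i) ^ 2 ≤ gBound p h := by
  have : gBound p h = ∑ i : Fin p, ((p.choose (i + 1) : ℝ) * h ^ ((i : ℕ) + 1)) ^ 2 := by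
    rw [gBound, Fin.sum_univ_eq_sum_range
      (fun i => ((p.choose (i + 1) : ℝ) * h ^ (i + 1)) ^ 2), Finset.range_eq_Ico,
      Finset.sum_Ico_add' (fun i => ((p.choose i : ℝ) * h ^ i) ^ 2)]
    rfl
  rw [this]
  refine Finset.sum_le_sum fun i _ => ?_
  rw [← sq_abs]
  exact pow_le_pow_left₀ (abs_nonneg _) (abs_coeff_le_of_mem_causalSet hh hv i) 2

/-- The last `p` values `[x_k, …, x_{k-p+1}]` of a signal. -/
def lagVector (p : ℕ) (x : ℤ → ℝ) (k : ℤ) : EuclideanSpace ℝ (Fin p) :=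
  WithLp.toLp 2 fun i : Fin p => x (k - (i : ℕ))

theorem inner_regressor_sub {p q : ℕ} (y y' u : ℤ → ℝ) (k : ℤ) (v : Param p q) :
    inner ℝ (regressor p q y u k - regressor p q y' u k) v =
      ∑ i : Fin p, v (Sum.inl i) * (y (k - 1 - (i : ℕ)) - y' (k - 1 - (i : ℕ))) := by
  simp [PiLp.inner_apply, regressor, Fintype.sum_sum_type]

/-- The input entries cancel in the difference, so only the autoregressive part of `v` enters, and
Cauchy–Schwarz applies. -/
theorem abs_inner_regressor_sub_le {p q : ℕ} {h : ℝ} (hh : 0 < h) {v : Param p q}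
    (hv : v ∈ causalSet p q h) (y y' u : ℤ → ℝ) (k : ℤ) :
    |inner ℝ (regressor p q y u k - regressor p q y' u k) v| ≤
      Real.sqrt (gBound p h) * ‖lagVector p (fun j => y j - y' j) (k - 1)‖ := by
  rw [inner_regressor_sub]
  refine Real.abs_le_sqrt (Finset.sum_mul_sq_le_sq_mul_sq _ _ _) |>.trans ?_
  rw [Real.sqrt_mul (Finset.sum_nonneg fun _ _ => sq_nonneg _), EuclideanSpace.norm_eq]
  simp only [lagVector, Real.norm_eq_abs, sq_abs]
  gcongr
  exact sum_sq_le_gBound hh hv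

end CoefficientBound

/-! ### Projection onto a convex set. -/

section Projection

variable {E : Type*} [NormedAddCommGroup E] {Λ : Set E}

theorem IsProjection.inner_le_zero [InnerProductSpace ℝ E] (hΛ : Convex ℝ Λ) {x w : E} (hw : IsProjection Λ x w) {l : E}
    (hl : l ∈ Λ) : inner ℝ (x - w) (l - w) ≤ 0 := by
  have : Nonempty Λ := ⟨⟨w, hw.1⟩⟩
  refine (norm_eq_iInf_iff_real_inner_le_zero hΛ hw.1).1 ?_ l hl
  refine le_antisymm (le_ciInf fun l => hw.2 l l.2) ?_
  exact ciInf_le (f := fun l : Λ => ‖x - l‖)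
    ⟨0, by rintro _ ⟨l, rfl⟩; exact norm_nonneg _⟩ ⟨w, hw.1⟩

theorem IsProjection.norm_sub_le [InnerProductSpace ℝ E] (hΛ : Convex ℝ Λ) {x w x' w' : E} (hw : IsProjection Λ x w)
    (hw' : IsProjection Λ x' w') : ‖w - w'‖ ≤ ‖x - x'‖ := by
  have h1 := hw.inner_le_zero hΛ hw'.1
  have h2 := hw'.inner_le_zero hΛ hw.1
  have h3 : ‖w - w'‖ ^ 2 ≤ inner ℝ (x - x') (w - w') := by
    rw [← real_inner_self_eq_norm_sq]
    simp only [inner_sub_left, inner_sub_right] at *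
    linarith
  have h4 := h3.trans (real_inner_le_norm _ _)
  rcases (norm_nonneg (w - w')).eq_or_lt with h0 | h0
  · rw [← h0]; exact norm_nonneg _
  · rw [pow_two] at h4
    exact le_of_mul_le_mul_right h4 h0

theorem IsProjection.unique [InnerProductSpace ℝ E] (hΛ : Convex ℝ Λ) {x w w' : E}
    (hw : IsProjection Λ x w) (hw' : IsProjection Λ x w') : w = w' := by
  have h := hw.norm_sub_le hΛ hw'
  rw [sub_self, norm_zero] at h
  exact sub_eq_zero.1 (norm_le_zero_iff.1 h)

theorem isProjection_self {x : E} (hx : x ∈ Λ) : IsProjection Λ x x :=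
  ⟨hx, fun l _ => by simp⟩

theorem exists_isProjection (hc : IsCompact Λ) (hne : Λ.Nonempty) (x : E) :
    ∃ w, IsProjection Λ x w := by
  obtain ⟨w, hw, hmin⟩ := hc.exists_isMinOn hne (f := fun l => ‖x - l‖) (by fun_prop)
  exact ⟨w, hw, fun l hl => hmin hl⟩

end Projection

/-! ### Scalar recursions with rate `1/k`. -/

section Recursions

/-- A stable linear recursion with input `O(1/k)` has output `O(1/k)`. -/
theorem exists_bound_of_stable_recursion (h c c₀ : ℝ) (hh0 : 0 ≤ h) (hh1 : h < 1) (hc : 0 ≤ c) :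
    ∃ K : ℝ, 0 ≤ K ∧ ∀ e : ℕ → ℝ, e 0 ≤ c₀ →
      (∀ k : ℕ, e (k + 1) ≤ h * e k + c / ((k : ℝ) + 1)) → ∀ k : ℕ, e k ≤ K / ((k : ℝ) + 1) := by
  obtain ⟨m, hm⟩ := exists_nat_ge (2 * h / (1 - h))
  have h1h : 0 < 1 - h := by linarith
  rw [div_le_iff₀ h1h] at hm
  -- The first summand covers `k ≤ m` through the linear growth bound. The second gives `4c ≤
  -- K(1-h)`; together with `2h ≤ (k+1)(1-h)` for `k ≥ m`, this lets the gap `1 - h` absorb both `c`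
  -- and the passage from `1/(k+1)` to `1/(k+2)`.
  set K := (|c₀| + m * c) * (m + 1) + 4 * c / (1 - h) with hK
  have hK0 : 0 ≤ 4 * c / (1 - h) := by positivity
  have hK1 : 0 ≤ (|c₀| + m * c) * (m + 1) := by positivity
  refine ⟨K, by positivity, fun e he0 he => ?_⟩
  have hlin : ∀ k : ℕ, e k ≤ |c₀| + k * c := by
    intro k
    induction k with
    | zero => simpa using he0.trans (le_abs_self _)
    | succ k ih =>
      have h1 : c / ((k : ℝ) + 1) ≤ c := div_le_self hc (by linarith [k.cast_nonneg (α := ℝ)])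
      have h2 : h * e k ≤ |c₀| + k * c := by
        refine (mul_le_mul_of_nonneg_left ih hh0).trans ?_
        exact mul_le_of_le_one_left (by positivity) hh1.le
      push_cast
      linarith [he k]
  intro k
  induction k with
  | zero =>
    have : |c₀| ≤ (|c₀| + m * c) * (m + 1) := by
      have := abs_nonneg c₀
      have : 0 ≤ (m : ℝ) * c := by positivity
      nlinarith [m.cast_nonneg (α := ℝ)]
    simp only [Nat.cast_zero, zero_add, div_one]
    linarith [le_abs_self c₀]
  | succ k ih =>
    by_cases hkm : k + 1 ≤ m
    · rw [le_div_iff₀ (by positivity)]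
      have hkm' : ((k + 1 : ℕ) : ℝ) ≤ m := by exact_mod_cast hkm
      calc e (k + 1) * (((k + 1 : ℕ) : ℝ) + 1) ≤ (|c₀| + m * c) * (m + 1) := by
            refine (mul_le_mul_of_nonneg_right (hlin (k + 1)) (by positivity)).trans ?_
            gcongr
        _ ≤ K := by linarith
    · have hkm' : (m : ℝ) ≤ k := by exact_mod_cast (by omega : m ≤ k)
      have hk : (0 : ℝ) < (k : ℝ) + 1 := by positivity
      refine (he k).trans ?_
      calc h * e k + c / ((k : ℝ) + 1) ≤ h * (K / ((k : ℝ) + 1)) + c / ((k : ℝ) + 1) := by gcongr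
        _ = (h * K + c) / ((k : ℝ) + 1) := by ring
        _ ≤ K / (((k + 1 : ℕ) : ℝ) + 1) := by
          rw [div_le_div_iff₀ hk (by positivity)]
          push_cast
          have hKc : 4 * c ≤ K * (1 - h) := by
            rw [hK, add_mul, div_mul_cancel₀ _ h1h.ne']
            nlinarith
          have hKn : 0 ≤ K := by positivity
          have h3 : 2 * h ≤ (k + 1) * (1 - h) := by nlinarith
          nlinarith [mul_le_mul_of_nonneg_right hKc hk.le, mul_le_mul_of_nonneg_left h3 hKn,
            mul_nonneg hc (k.cast_nonneg (α := ℝ))]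

/-- Chung's lemma for a recursion with time step `N`. -/
theorem isBigO_of_chung_recursion (v : ℕ → ℝ) (N : ℕ) (hN : 0 < N) (α c R : ℝ) (hα : 1 < α)
    (hv0 : ∀ n, 0 ≤ v n) (hR : ∀ n, v n ≤ R)
    (hv : ∀ n : ℕ, 1 ≤ n → v (n + N) ≤ (1 - α * N / n) * v n + c / (n : ℝ) ^ 2) :
    v =O[atTop] fun k : ℕ => 1 / (k : ℝ) := by
  -- Beyond `m` the contraction factor is nonnegative, so the induction hypothesis may be multiplied
  -- by it.
  obtain ⟨m, hm⟩ := exists_nat_ge (α * N)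
  have hNR : (0 : ℝ) < N := by exact_mod_cast hN
  have hα1 : 0 < α - 1 := by linarith
  have hR0 : 0 ≤ R := (hv0 0).trans (hR 0)
  -- The first summand settles the indices up to `m + N`; the second gives `|c| ≤ K(α-1)N`, which
  -- closes the induction with `K N²` to spare.
  set K := R * (m + N) + |c| / ((α - 1) * N) with hK
  have hK0 : 0 ≤ K := by positivity
  have main : ∀ n : ℕ, 1 ≤ n → v n ≤ K / n := by
    intro n
    induction n using Nat.strong_induction_on with
    | _ n ih =>
      intro hn
      have hnR : (0 : ℝ) < n := by exact_mod_cast hn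
      by_cases hnm : n ≤ m + N
      · rw [le_div_iff₀ hnR]
        have h1 : (n : ℝ) ≤ m + N := by exact_mod_cast hnm
        calc v n * n ≤ R * (m + N) := by gcongr; exact hR n
          _ ≤ K := by rw [hK]; linarith [show 0 ≤ |c| / ((α - 1) * N) by positivity]
      · obtain ⟨k, rfl⟩ : ∃ k, n = k + N := ⟨n - N, by omega⟩
        have hk : m + 1 ≤ k := by omega
        have hkR : (0 : ℝ) < k := by exact_mod_cast (by omega : 0 < k)
        have hkm : (m : ℝ) ≤ k := by exact_mod_cast (by omega : m ≤ k)
        have hfac : 0 ≤ 1 - α * N / k := by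
          rw [sub_nonneg, div_le_one hkR]; linarith
        refine (hv k (by omega)).trans ?_
        calc (1 - α * N / k) * v k + c / (k : ℝ) ^ 2
            ≤ (1 - α * N / k) * (K / k) + |c| / (k : ℝ) ^ 2 := by
              gcongr
              · exact ih k (by omega) (by omega)
              · exact le_abs_self c
          _ = (K * (k - α * N) + |c|) / (k : ℝ) ^ 2 := by field_simp
          _ ≤ K / ((k + N : ℕ) : ℝ) := by
            push_cast
            rw [div_le_div_iff₀ (by positivity) (by positivity)]
            have hKc : |c| ≤ K * ((α - 1) * N) := by
              rw [hK, add_mul, div_mul_cancel₀ _ (by positivity)]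
              have : 0 ≤ R * (m + N) * ((α - 1) * N) := by positivity
              linarith
            have h1 : |c| * (k + N) ≤ K * ((α - 1) * N) * (k + N) := by gcongr
            have h2 : 0 ≤ K * N * N := by positivity
            nlinarith
  refine IsBigO.of_bound K ?_
  filter_upwards [eventually_ge_atTop 1] with n hn
  have hnR : (0 : ℝ) < n := by exact_mod_cast hn
  rw [Real.norm_of_nonneg (hv0 n), Real.norm_of_nonneg (by positivity), mul_one_div]
  exact main n hn

end Recursions

/-! ### Estimates in an abstract normed or inner product space. -/

section AbstractEstimates

variable {E : Type*} [NormedAddCommGroup E]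

/-- If the powers of `T` decay geometrically and the input is bounded by `M₂ t` for a slowly varying
`t`, then the output is bounded by `M M₂ / (1 - h) t` up to `O(1/k)`. -/
theorem exists_bound_of_driven_recursion [NormedSpace ℝ E] (T : E →L[ℝ] E) (M h M₂ c r : ℝ)
    (hT : ∀ k, ‖T ^ k‖ ≤ M * h ^ k) (hh0 : 0 ≤ h) (hh1 : h < 1) (hM : 0 ≤ M) (hM₂ : 0 ≤ M₂)
    (hc : 0 ≤ c) :
    ∃ K : ℝ, 0 ≤ K ∧ ∀ (x b : ℕ → E) (t : ℕ → ℝ), ‖x 0‖ ≤ r →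
      (∀ k, x (k + 1) = T (x k) + b (k + 1)) → (∀ k, 0 ≤ t k) → (∀ k, ‖b (k + 1)‖ ≤ M₂ * t (k + 1)) →
      (∀ k : ℕ, t k - t (k + 1) ≤ c / ((k : ℝ) + 1)) →
      ∀ k : ℕ, ‖x k‖ ≤ M * M₂ / (1 - h) * t k + K / ((k : ℝ) + 1) := by
  set L := M * M₂ / (1 - h) with hL
  have h1h : 0 < 1 - h := by linarith
  have hL0 : 0 ≤ L := by positivity
  obtain ⟨K, hK0, hK⟩ := exists_bound_of_stable_recursion h (h * L * c) (M * r) hh0 hh1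
    (by positivity)
  refine ⟨K, hK0, fun x b t hx0 hx ht hb htc k => ?_⟩
  let R : ℕ → ℝ := fun k => Nat.rec (M * r) (fun k S => h * S + M * (M₂ * t (k + 1))) k
  have hR0 : R 0 = M * r := rfl
  have hRs : ∀ k, R (k + 1) = h * R k + M * (M₂ * t (k + 1)) := fun k => rfl
  -- Bounding all the iterates `T ^ j (x k)` at once makes `M` enter once per input term; an
  -- induction on `‖x k‖` alone would multiply by `M` at each step.
  have hxR : ∀ k j, ‖(T ^ j) (x k)‖ ≤ h ^ j * R k := by
    intro k
    induction k with
    | zero =>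
      intro j
      calc ‖(T ^ j) (x 0)‖ ≤ M * h ^ j * ‖x 0‖ := (T ^ j).le_of_opNorm_le (hT j) _
        _ ≤ M * h ^ j * r := by gcongr
        _ = h ^ j * R 0 := by rw [hR0]; ring
    | succ k ih =>
      intro j
      have h1 : (T ^ j) (x (k + 1)) = (T ^ (j + 1)) (x k) + (T ^ j) (b (k + 1)) := by
        rw [hx, map_add, pow_succ]; rfl
      have h2 : ‖(T ^ j) (b (k + 1))‖ ≤ M * h ^ j * (M₂ * t (k + 1)) :=
        ((T ^ j).le_of_opNorm_le (hT j) _).trans (by gcongr; exact hb k)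
      rw [h1, hRs]
      calc _ ≤ h ^ (j + 1) * R k + M * h ^ j * (M₂ * t (k + 1)) :=
            (norm_add_le _ _).trans (add_le_add (ih (j + 1)) h2)
        _ = _ := by ring
  have hMM : M * M₂ = L * (1 - h) := by rw [hL, div_mul_cancel₀ _ h1h.ne']
  -- `L t` is the equilibrium level of `R` for frozen `t`. The deviation from it contracts by `h`
  -- and is driven only by `h L (t k - t (k + 1))`.
  have hfin := hK (fun k => R k - L * t k)
    (by simp only [hR0]; linarith [mul_nonneg hL0 (ht 0)])
    (fun k => by
      simp only [hRs]
      have h3 := mul_le_mul_of_nonneg_left (htc k) (mul_nonneg hh0 hL0)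
      have h4 : M * (M₂ * t (k + 1)) = L * (1 - h) * t (k + 1) := by rw [← hMM]; ring
      rw [h4, mul_div_assoc (h * L)]
      linarith) k
  have := hxR k 0
  simp only [pow_zero, one_mul, one_apply_eq_self] at this
  linarith

/-- The mean value theorem in a form symmetric in `x` and `z`, including `x = z`, so that a
difference of `F` becomes linear in its argument. -/
theorem exists_slope_mem {F f : ℝ → ℝ} (hF : ∀ x, HasDerivAt F (f x) x) {a b fm fM : ℝ}
    (hf : ∀ x ∈ Set.Icc a b, fm ≤ f x ∧ f x ≤ fM) {x z : ℝ} (hx : x ∈ Set.Icc a b)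
    (hz : z ∈ Set.Icc a b) : ∃ m, fm ≤ m ∧ m ≤ fM ∧ F x - F z = m * (x - z) := by
  have key : ∀ {x z : ℝ}, x ∈ Set.Icc a b → z ∈ Set.Icc a b → x < z →
      ∃ m, fm ≤ m ∧ m ≤ fM ∧ F x - F z = m * (x - z) := by
    intro x z hx hz hxz
    obtain ⟨m, hm, hmf⟩ := exists_hasDerivAt_eq_slope F f hxz
      (fun w _ => (hF w).continuousAt.continuousWithinAt) (fun w _ => hF w)
    have hmem : m ∈ Set.Icc a b := ⟨hx.1.trans hm.1.le, hm.2.le.trans hz.2⟩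
    refine ⟨f m, (hf m hmem).1, (hf m hmem).2, ?_⟩
    rw [hmf]
    have : z - x ≠ 0 := by linarith
    field_simp
    ring
  rcases lt_trichotomy x z with hxz | rfl | hxz
  · exact key hx hz hxz
  · exact ⟨f x, (hf x hx).1, (hf x hx).2, by simp⟩
  · obtain ⟨m, h1, h2, h3⟩ := key hz hx hxz
    exact ⟨m, h1, h2, by linarith⟩

variable [InnerProductSpace ℝ E]

/-- The mean correction of the algorithm points towards `θ`, up to the error `ρ` of the
regressor. -/
theorem inner_mul_correction_le {F f : ℝ → ℝ} (hF : ∀ x, HasDerivAt F (f x) x)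
    {C b fm fM : ℝ} (hfm : 0 ≤ fm) (hf : ∀ x ∈ Set.Icc (C - b) (C + b), fm ≤ f x ∧ f x ≤ fM)
    {φ ψ t θ : E} {M₁ M₂ ρ : ℝ} (hφ : ‖φ‖ ≤ M₂) (hψ : ‖ψ‖ ≤ M₁)
    (hφt : |inner ℝ φ t| ≤ b) (hψt : |inner ℝ ψ t| ≤ b) (hψθ : |inner ℝ ψ θ| ≤ b)
    (hρt : |inner ℝ (φ - ψ) t| ≤ ρ) (hρθ : |inner ℝ (φ - ψ) θ| ≤ ρ) :
    inner ℝ φ (t - θ) * (F (C - inner ℝ φ t) - F (C - inner ℝ ψ θ)) ≤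
      -fm * inner ℝ ψ (t - θ) ^ 2 + fM * ρ * (M₂ + 2 * M₁) * ‖t - θ‖ := by
  have hmem : ∀ {a : ℝ}, |a| ≤ b → C - a ∈ Set.Icc (C - b) (C + b) := by
    intro a ha
    constructor <;> linarith [(abs_le.1 ha).1, (abs_le.1 ha).2]
  obtain ⟨m₁, h1m, h1M, h1⟩ := exists_slope_mem hF hf (hmem hφt) (hmem hψt)
  obtain ⟨m₂, h2m, h2M, h2⟩ := exists_slope_mem hF hf (hmem hψt) (hmem hψθ)
  have hρ0 : 0 ≤ ρ := (abs_nonneg _).trans hρt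
  have hfM : 0 ≤ fM := hfm.trans (h1m.trans h1M)
  have hM₁ : 0 ≤ M₁ := (norm_nonneg _).trans hψ
  have hM₂ : 0 ≤ M₂ := (norm_nonneg _).trans hφ
  have e1 : |inner ℝ φ (t - θ)| ≤ M₂ * ‖t - θ‖ :=
    (abs_real_inner_le_norm _ _).trans (by gcongr)
  have e2 : |inner ℝ ψ (t - θ)| ≤ M₁ * ‖t - θ‖ :=
    (abs_real_inner_le_norm _ _).trans (by gcongr)
  have e3 : |inner ℝ (φ - ψ) (t - θ)| ≤ 2 * ρ := by
    rw [inner_sub_right]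
    linarith [abs_sub (inner ℝ (φ - ψ) t) (inner ℝ (φ - ψ) θ)]
  have hsum : F (C - inner ℝ φ t) - F (C - inner ℝ ψ θ) =
      -m₁ * inner ℝ (φ - ψ) t - m₂ * inner ℝ ψ (t - θ) := by
    have : F (C - inner ℝ φ t) - F (C - inner ℝ ψ θ) =
      (F (C - inner ℝ φ t) - F (C - inner ℝ ψ t)) + (F (C - inner ℝ ψ t) - F (C - inner ℝ ψ θ)) := by
      ring
    rw [this, h1, h2, inner_sub_left, inner_sub_right]
    ring
  have hdec : inner ℝ φ (t - θ) = inner ℝ (φ - ψ) (t - θ) + inner ℝ ψ (t - θ) := by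
    rw [inner_sub_left]; ring
  have hm₁ : |m₁| ≤ fM := abs_le.2 ⟨by linarith, h1M⟩
  have hm₂ : |m₂| ≤ fM := abs_le.2 ⟨by linarith, h2M⟩
  have t1 : inner ℝ φ (t - θ) * (-m₁ * inner ℝ (φ - ψ) t) ≤ M₂ * ‖t - θ‖ * (fM * ρ) := by
    refine (le_abs_self _).trans ?_
    rw [abs_mul, abs_mul, abs_neg]
    gcongr
  have t2 : -(m₂ * (inner ℝ (φ - ψ) (t - θ) * inner ℝ ψ (t - θ))) ≤
      fM * (2 * ρ * (M₁ * ‖t - θ‖)) := by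
    refine (neg_le_abs _).trans ?_
    rw [abs_mul, abs_mul]
    gcongr
  have t3 : fm * inner ℝ ψ (t - θ) ^ 2 ≤ m₂ * inner ℝ ψ (t - θ) ^ 2 := by gcongr
  -- Only in the product with `m₂` is `φ` split as `(φ - ψ) + ψ`. The other product keeps `φ`, which
  -- accounts for `M₂` once and `M₁` twice.
  have hexp : inner ℝ φ (t - θ) * (F (C - inner ℝ φ t) - F (C - inner ℝ ψ θ)) =
      inner ℝ φ (t - θ) * (-m₁ * inner ℝ (φ - ψ) t) +
      -(m₂ * (inner ℝ (φ - ψ) (t - θ) * inner ℝ ψ (t - θ))) - m₂ * inner ℝ ψ (t - θ) ^ 2 := by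
    rw [hsum, mul_sub]
    nth_rewrite 2 [hdec]
    ring
  rw [hexp]
  linarith

/-- Summation of the one-step inequality over a window of length `N`. -/
theorem exists_window_bound (ψ : ℕ → E) (N : ℕ) (γ fm δ K M₁ R c₁ c₂ : ℝ) (hγ : 0 ≤ γ)
    (hfm : 0 ≤ fm) (hK : 0 ≤ K) (hc₁ : 0 ≤ c₁) (hR : 0 ≤ R) (hψ : ∀ k, 1 ≤ k → ‖ψ k‖ ≤ M₁)
    (hex : ∀ k, 1 ≤ k → ∀ x, N * (δ * ‖x‖ ^ 2) ≤
      ∑ i ∈ Finset.range N, inner ℝ (ψ (k + i)) x ^ 2) :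
    ∃ c : ℝ, ∀ (x : ℕ → E) (ζ : ℕ → ℝ), (∀ k, 1 ≤ k → ‖x k‖ ≤ R) →
      (∀ k : ℕ, 1 ≤ k → ‖x (k + 1) - x k‖ ≤ c₁ / k) →
      (∀ k : ℕ, 1 ≤ k → ‖x (k + 1)‖ ^ 2 ≤ ‖x k‖ ^ 2 + 2 * γ / ((k : ℝ) + 1) *
        (-fm * inner ℝ (ψ (k + 1)) (x k) ^ 2 + K * ‖x k‖ ^ 2 + ζ (k + 1)) + c₂ / (k : ℝ) ^ 2) →
      ∀ n : ℕ, 1 ≤ n → ‖x (n + N)‖ ^ 2 ≤ (1 - 2 * γ * (fm * δ - K) * N / n) * ‖x n‖ ^ 2 +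
        c / (n : ℝ) ^ 2 +
        ∑ i ∈ Finset.range N, 2 * γ / (((n + i : ℕ) : ℝ) + 1) * ζ (n + i + 1) := by
  set G := fm * (M₁ * R) ^ 2 + K * R ^ 2 with hG
  -- `c₃ / n` is the price of replacing `x (n + m)` by `x n` in the quadratic terms; `G` bounds `-β`
  -- and prices the replacement of the step `1/(n+m+1)` by `1/n`.
  set c₃ := (fm * M₁ ^ 2 + K) * (2 * R * (N * c₁)) with hc₃
  set c₄ := 2 * γ * (G * N + c₃) + |c₂| with hc₄
  have hG0 : 0 ≤ G := by positivity
  have hc₃0 : 0 ≤ c₃ := by positivity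
  refine ⟨N * c₄, fun x ζ hxR hxd hstep n hn => ?_⟩
  have hnR : (0 : ℝ) < n := by exact_mod_cast hn
  have hdist : ∀ m : ℕ, ‖x (n + m) - x n‖ ≤ m * c₁ / n := by
    intro m
    induction m with
    | zero => simp
    | succ m ih =>
      have h1 : ‖x (n + m + 1) - x (n + m)‖ ≤ c₁ / n := by
        refine (hxd (n + m) (by omega)).trans ?_
        gcongr
        omega
      calc ‖x (n + (m + 1)) - x n‖ = ‖(x (n + m + 1) - x (n + m)) + (x (n + m) - x n)‖ := by
            rw [sub_add_sub_cancel]; rfl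
        _ ≤ c₁ / n + m * c₁ / n := (norm_add_le _ _).trans (add_le_add h1 ih)
        _ = _ := by push_cast; ring
  set β : ℕ → ℝ := fun i => -fm * inner ℝ (ψ (n + i + 1)) (x n) ^ 2 + K * ‖x n‖ ^ 2 with hβ
  have main : ∀ m ≤ N, ‖x (n + m)‖ ^ 2 ≤ ‖x n‖ ^ 2 + 2 * γ / n * ∑ i ∈ Finset.range m, β i +
      m * (c₄ / (n : ℝ) ^ 2) +
      ∑ i ∈ Finset.range m, 2 * γ / (((n + i : ℕ) : ℝ) + 1) * ζ (n + i + 1) := by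
    intro m
    induction m with
    | zero => intro _; simp
    | succ m ih =>
      intro hm
      have hs := hstep (n + m) (by omega)
      set a := -fm * inner ℝ (ψ (n + m + 1)) (x (n + m)) ^ 2 + K * ‖x (n + m)‖ ^ 2 with ha
      have hψm := hψ (n + m + 1) (by omega)
      have hM₁ : 0 ≤ M₁ := (norm_nonneg _).trans hψm
      have hd : ‖x (n + m) - x n‖ ≤ N * c₁ / n := (hdist m).trans (by
        gcongr; omega)
      have hxn := hxR n hn
      have hxm := hxR (n + m) (by omega)
      have hab : a ≤ β m + c₃ / n := by
        have e1 : inner ℝ (ψ (n + m + 1)) (x n) ^ 2 - inner ℝ (ψ (n + m + 1)) (x (n + m)) ^ 2 ≤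
            M₁ * (N * c₁ / n) * (M₁ * (2 * R)) := by
          have : inner ℝ (ψ (n + m + 1)) (x n) ^ 2 - inner ℝ (ψ (n + m + 1)) (x (n + m)) ^ 2 =
              inner ℝ (ψ (n + m + 1)) (x n - x (n + m)) *
                inner ℝ (ψ (n + m + 1)) (x n + x (n + m)) := by
            rw [inner_sub_right, inner_add_right]; ring
          rw [this]
          refine (le_abs_self _).trans ?_
          rw [abs_mul]
          refine mul_le_mul ((abs_real_inner_le_norm _ _).trans ?_)
            ((abs_real_inner_le_norm _ _).trans ?_) (abs_nonneg _) (by positivity)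
          · rw [norm_sub_rev]; gcongr
          · gcongr
            exact (norm_add_le _ _).trans (by linarith)
        have e2 : ‖x (n + m)‖ ^ 2 - ‖x n‖ ^ 2 ≤ (N * c₁ / n) * (2 * R) := by
          have h3 : ‖x (n + m)‖ - ‖x n‖ ≤ N * c₁ / n := (norm_sub_norm_le _ _).trans hd
          have h4 : ‖x (n + m)‖ + ‖x n‖ ≤ 2 * R := by linarith
          calc _ = (‖x (n + m)‖ - ‖x n‖) * (‖x (n + m)‖ + ‖x n‖) := by ring
            _ ≤ (N * c₁ / n) * (‖x (n + m)‖ + ‖x n‖) := by gcongr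
            _ ≤ _ := by gcongr
        have e3 := mul_le_mul_of_nonneg_left e1 hfm
        have e4 := mul_le_mul_of_nonneg_left e2 hK
        have e5 : c₃ / n = fm * (M₁ * (N * c₁ / n) * (M₁ * (2 * R))) +
            K * ((N * c₁ / n) * (2 * R)) := by rw [hc₃]; ring
        rw [e5, ha, hβ]
        linarith
      have hβG : -β m ≤ G := by
        have e1 : inner ℝ (ψ (n + m + 1)) (x n) ^ 2 ≤ (M₁ * R) ^ 2 := by
          rw [← sq_abs]
          exact pow_le_pow_left₀ (abs_nonneg _) ((abs_real_inner_le_norm _ _).trans (by gcongr)) 2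
        have e2 := mul_le_mul_of_nonneg_left e1 hfm
        have e3 : 0 ≤ K * ‖x n‖ ^ 2 := by positivity
        have e4 : 0 ≤ K * R ^ 2 := by positivity
        simp only [hβ, hG]
        linarith
      have hdiv : a / (((n + m : ℕ) : ℝ) + 1) ≤ β m / n + (G * N + c₃) / (n : ℝ) ^ 2 := by
        set n' : ℝ := ((n + m : ℕ) : ℝ) + 1 with hn'
        have hnn' : (n : ℝ) ≤ n' := by rw [hn']; push_cast; linarith [m.cast_nonneg (α := ℝ)]
        have hn'0 : 0 < n' := by linarith
        have hn'N : n' - n ≤ N := by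
          have : ((m + 1 : ℕ) : ℝ) ≤ N := by exact_mod_cast hm
          rw [hn']; push_cast at this ⊢; linarith
        have f1 : a / n' ≤ (β m + c₃ / n) / n' := by gcongr
        have f2 : c₃ / n / n' ≤ c₃ / (n : ℝ) ^ 2 := by
          rw [div_div, pow_two]; gcongr
        have f3 : β m / n' - β m / n ≤ G * N / (n : ℝ) ^ 2 := by
          have : β m / n' - β m / n = (-β m) * (n' - n) / (n * n') := by field_simp; ring
          rw [this, pow_two]
          have hnn : 0 ≤ n' - n := by linarith
          gcongr
        rw [add_div (β m)] at f1
        rw [add_div (G * N)]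
        linarith
      have hγdiv := mul_le_mul_of_nonneg_left hdiv (by linarith : 0 ≤ 2 * γ)
      have hc₂ : c₂ / ((n + m : ℕ) : ℝ) ^ 2 ≤ |c₂| / (n : ℝ) ^ 2 := by
        have : (n : ℝ) ≤ ((n + m : ℕ) : ℝ) := by exact_mod_cast (by omega)
        gcongr
        exact le_abs_self _
      have hc₄d : c₄ / (n : ℝ) ^ 2 = 2 * γ * ((G * N + c₃) / (n : ℝ) ^ 2) +
          |c₂| / (n : ℝ) ^ 2 := by rw [hc₄]; ring
      have hexp : 2 * γ / (((n + m : ℕ) : ℝ) + 1) * (a + ζ (n + m + 1)) =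
          2 * γ * (a / (((n + m : ℕ) : ℝ) + 1)) +
            2 * γ / (((n + m : ℕ) : ℝ) + 1) * ζ (n + m + 1) := by ring
      have hexp' : 2 * γ / n * (∑ i ∈ Finset.range m, β i + β m) =
          2 * γ / n * ∑ i ∈ Finset.range m, β i + 2 * γ * (β m / n) := by ring
      rw [hexp] at hs
      rw [Finset.sum_range_succ, Finset.sum_range_succ, hexp', ← add_assoc n m 1]
      push_cast [-Nat.cast_add] at hs ⊢
      have := ih (by omega)
      rw [add_mul, one_mul]
      linarith
  have hfin := main N le_rfl
  -- With the vector frozen at `x n`, excitation applies to the window that starts at `n + 1`.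
  have hsumβ : ∑ i ∈ Finset.range N, β i ≤ -(N * ((fm * δ - K) * ‖x n‖ ^ 2)) := by
    have h1 := mul_le_mul_of_nonneg_left (hex (n + 1) (by omega) (x n)) hfm
    have h2 : ∑ i ∈ Finset.range N, β i = -(fm * ∑ i ∈ Finset.range N,
        inner ℝ (ψ (n + 1 + i)) (x n) ^ 2) + N * (K * ‖x n‖ ^ 2) := by
      simp only [hβ, Finset.sum_add_distrib, Finset.sum_const, Finset.card_range, nsmul_eq_mul,
        ← Finset.mul_sum, add_right_comm n _ 1, neg_mul, Finset.sum_neg_distrib]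
    rw [h2]
    linarith
  have h3 := mul_le_mul_of_nonneg_left hsumβ (by positivity : 0 ≤ 2 * γ / (n : ℝ))
  have h4 : (1 - 2 * γ * (fm * δ - K) * N / n) * ‖x n‖ ^ 2 =
      ‖x n‖ ^ 2 + 2 * γ / n * -(N * ((fm * δ - K) * ‖x n‖ ^ 2)) := by ring
  rw [h4, mul_div_assoc (N : ℝ) c₄]
  linarith

end AbstractEstimates

/-! ### Pathwise analysis of the algorithm. -/

section Trajectory

variable {p q : ℕ} {θ : Param p q} {u y : ℤ → ℝ} {γ C : ℝ} {F : ℝ → ℝ} {Θ : Set (Param p q)}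
  {s : ℕ → ℝ} {θhat : ℕ → Param p q} {yhat : ℤ → ℝ}

theorem inner_regressor (v : Param p q) (y u : ℤ → ℝ) (k : ℤ) :
    inner ℝ (regressor p q y u k) v = ∑ i : Fin p, v (Sum.inl i) * y (k - 1 - (i : ℕ)) +
      ∑ j : Fin q, v (Sum.inr j) * u (k - (j : ℕ)) := by
  simp [PiLp.inner_apply, regressor, Fintype.sum_sum_type]

theorem IsOutput.eq_inner (hy : IsOutput θ u y) {k : ℕ} (hk : 1 ≤ k) :
    y k = inner ℝ (regressor p q y u k) θ := by
  rw [inner_regressor, hy k hk]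

/-- The prediction errors follow the autoregression of the model, driven by the parameter errors. -/
theorem IsTrajectory.lagVector_succ (hp : 0 < p) (hy : IsOutput θ u y)
    (ht : IsTrajectory γ C F Θ u s θhat yhat) (k : ℕ) :
    lagVector p (fun j => yhat j - y j) ((k + 1 : ℕ) : ℤ) =
      Matrix.toEuclideanCLM (n := Fin p) (𝕜 := ℝ) (companion θ)
        (lagVector p (fun j => yhat j - y j) (k : ℤ)) +
      EuclideanSpace.single (⟨0, hp⟩ : Fin p)
        (inner ℝ (regressor p q yhat u ((k + 1 : ℕ) : ℤ)) (θhat (k + 1) - θ)) := by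
  ext i
  rw [PiLp.add_apply, Matrix.ofLp_toEuclideanCLM]
  obtain ⟨i, hi⟩ := i
  rcases i with _ | i
  · have h1 : yhat ((k + 1 : ℕ) : ℤ) - y ((k + 1 : ℕ) : ℤ) =
        inner ℝ (regressor p q yhat u ((k + 1 : ℕ) : ℤ)) (θhat (k + 1) - θ) +
        inner ℝ (regressor p q yhat u ((k + 1 : ℕ) : ℤ) - regressor p q y u ((k + 1 : ℕ) : ℤ)) θ := by
      rw [ht.prediction (k + 1) (by omega), hy.eq_inner (k := k + 1) (by omega), inner_sub_left,
        inner_sub_right]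
      ring
    rw [inner_regressor_sub] at h1
    have h2 : lagVector p (fun j => yhat j - y j) ((k + 1 : ℕ) : ℤ) ⟨0, hi⟩ =
        yhat ((k + 1 : ℕ) : ℤ) - y ((k + 1 : ℕ) : ℤ) := by
      simp [lagVector]
    rw [h2, h1, add_comm]
    congr 1
    simp [Matrix.mulVec, dotProduct, companion, lagVector]
  · have h3 : (⟨i + 1, hi⟩ : Fin p) ≠ ⟨0, hp⟩ := by simp
    simp only [PiLp.single_apply, if_neg h3, add_zero, Matrix.mulVec, dotProduct, companion,
      Matrix.of_apply, Nat.add_one_ne_zero, if_false, lagVector, Nat.add_right_cancel_iff]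
    rw [Finset.sum_eq_single ⟨i, by omega⟩]
    · simp
    · intro j _ hj
      have : i ≠ j := fun e => hj (Fin.ext e.symm)
      simp [this]
    · simp

theorem IsTrajectory.mem (ht : IsTrajectory γ C F Θ u s θhat yhat) {k : ℕ} (hk : 1 ≤ k) :
    θhat k ∈ Θ :=
  (ht.estimate k hk).1

theorem abs_sub_le_one {a b : ℝ} (ha : 0 ≤ a ∧ a ≤ 1) (hb : 0 ≤ b ∧ b ≤ 1) : |a - b| ≤ 1 :=
  abs_le.2 ⟨by linarith [ha.1, hb.2], by linarith [ha.2, hb.1]⟩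

theorem IsTrajectory.norm_succ_sub_le (hΘ : Convex ℝ Θ) (hγ : 0 ≤ γ)
    (hF : ∀ x, 0 ≤ F x ∧ F x ≤ 1) (hs : ∀ k, 0 ≤ s k ∧ s k ≤ 1) {M₂ : ℝ}
    (hM₂ : ∀ k : ℕ, 1 ≤ k → ‖regressor p q yhat u k‖ ≤ M₂)
    (ht : IsTrajectory γ C F Θ u s θhat yhat) {k : ℕ} (hk : 1 ≤ k) :
    ‖θhat (k + 1) - θhat k‖ ≤ γ * M₂ / ((k : ℝ) + 1) := by
  have h1 := (ht.estimate (k + 1) (by omega)).norm_sub_le hΘ (isProjection_self (ht.mem hk))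
  rw [Nat.add_sub_cancel, add_sub_cancel_left, norm_smul, Real.norm_eq_abs, abs_mul] at h1
  refine h1.trans ?_
  have h2 := hM₂ (k + 1) (by omega)
  have h3 : |γ / ((k + 1 : ℕ) : ℝ)| = γ / ((k : ℝ) + 1) := by
    rw [abs_of_nonneg (by positivity)]; push_cast; rfl
  rw [h3]
  calc _ ≤ γ / ((k : ℝ) + 1) * 1 * M₂ := by
        gcongr
        exact abs_sub_le_one (hF _) (hs _)
    _ = _ := by ring

/-- `θ` is its own projection, so nonexpansiveness removes the projection and the square can be
expanded. The starting point `θhat 0` need not lie in `Θ`. -/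
theorem IsTrajectory.norm_sq_succ_le (hΘ : Convex ℝ Θ) (hθ : θ ∈ Θ) (hγ : 0 ≤ γ)
    (hF : ∀ x, 0 ≤ F x ∧ F x ≤ 1) (hs : ∀ k, 0 ≤ s k ∧ s k ≤ 1) {M₂ : ℝ}
    (hM₂ : ∀ k : ℕ, 1 ≤ k → ‖regressor p q yhat u k‖ ≤ M₂)
    (ht : IsTrajectory γ C F Θ u s θhat yhat) (k : ℕ) :
    ‖θhat (k + 1) - θ‖ ^ 2 ≤ ‖θhat k - θ‖ ^ 2 + 2 * γ / ((k : ℝ) + 1) *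
      (inner ℝ (regressor p q yhat u ((k + 1 : ℕ) : ℤ)) (θhat k - θ) *
        (F (C - inner ℝ (regressor p q yhat u ((k + 1 : ℕ) : ℤ)) (θhat k)) - s (k + 1))) +
      (γ * M₂ / ((k : ℝ) + 1)) ^ 2 := by
  have h1 := (ht.estimate (k + 1) (by omega)).norm_sub_le hΘ (isProjection_self hθ)
  rw [Nat.add_sub_cancel, add_sub_right_comm] at h1
  have h2 := pow_le_pow_left₀ (norm_nonneg _) h1 2
  rw [norm_add_sq_real, norm_smul, inner_smul_right,
    real_inner_comm (regressor p q yhat u ((k + 1 : ℕ) : ℤ)) (θhat k - θ), Real.norm_eq_abs, abs_mul,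
    abs_of_nonneg (by positivity : 0 ≤ γ / ((k + 1 : ℕ) : ℝ))] at h2
  have h3 := hM₂ (k + 1) (by omega)
  have h4 := abs_sub_le_one
    (hF (C - inner ℝ (regressor p q yhat u ((k + 1 : ℕ) : ℤ)) (θhat k))) (hs (k + 1))
  have h5 : (γ / ((k + 1 : ℕ) : ℝ) *
      |F (C - inner ℝ (regressor p q yhat u ((k + 1 : ℕ) : ℤ)) (θhat k)) - s (k + 1)| *
      ‖regressor p q yhat u ((k + 1 : ℕ) : ℤ)‖) ^ 2 ≤ (γ * M₂ / ((k : ℝ) + 1)) ^ 2 := by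
    have : γ * M₂ / ((k : ℝ) + 1) = γ / ((k + 1 : ℕ) : ℝ) * 1 * M₂ := by push_cast; ring
    rw [this]
    gcongr
  refine h2.trans ?_
  refine le_trans (add_le_add le_rfl h5) (le_of_eq ?_)
  push_cast
  ring

/-- The deterministic part of the convergence proof: a contraction of the squared error over a
window of length `N`, up to `O(1/n²)` and a weighted sum of centered noise terms. -/
theorem exists_trajectory_bound (hp : 0 < p) (hy : IsOutput θ u y) {h : ℝ} (hh0 : 0 < h)
    (hΘconv : Convex ℝ Θ) (hΘsub : Θ ⊆ causalSet p q h) (hθ : θ ∈ Θ)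
    {B : ℝ} (hB : ∀ v ∈ Θ, ‖v‖ ≤ B) {f : ℝ → ℝ} (hF : ∀ x, HasDerivAt F (f x) x)
    (hF01 : ∀ x, 0 ≤ F x ∧ F x ≤ 1) (hγ : 0 ≤ γ) (θ₀ : Param p q) (y₀ : ℤ → ℝ)
    {ε h₁ : ℝ} (hε : 0 < ε)
    (hh₁ : specRadius (companion θ) + ε * opNorm (companion θ) ≤ h₁) (hh₁lt : h₁ < 1)
    {M₁ M₂ : ℝ} (hM₁pos : 0 < M₁) (hM₂pos : 0 < M₂)
    (hM₁ : ∀ k : ℕ, 1 ≤ k → ‖regressor p q y u k‖ ≤ M₁)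
    {N : ℕ} (hN : 0 < N) {δ : ℝ} (hδ : Excites (regressor p q y u) N δ)
    {fm fM : ℝ} (hfm : 0 ≤ fm)
    (hf : ∀ x ∈ Set.Icc (C - B * M₂) (C + B * M₂) ∪ Set.Icc (C - B * M₁) (C + B * M₁),
      fm ≤ f x ∧ f x ≤ fM) :
    ∃ c : ℝ, ∀ (s : ℕ → ℝ) (θhat : ℕ → Param p q) (yhat : ℤ → ℝ), θhat 0 = θ₀ →
      (∀ k ≤ 0, yhat k = y₀ k) → IsTrajectory γ C F Θ u s θhat yhat →
      (∀ k, 0 ≤ s k ∧ s k ≤ 1) → (∀ k : ℕ, 1 ≤ k → ‖regressor p q yhat u k‖ ≤ M₂) →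
      ∀ n : ℕ, 1 ≤ n → ‖θhat (n + N) - θ‖ ^ 2 ≤
        (1 - 2 * γ * margin fm fM δ (gBound p h) (powConst p ε) M₁ M₂ h₁ * N / n) *
          ‖θhat n - θ‖ ^ 2 + c / (n : ℝ) ^ 2 +
        ∑ i ∈ Finset.range N, 2 * γ / (((n + i : ℕ) : ℝ) + 1) *
          (inner ℝ (regressor p q yhat u ((n + i + 1 : ℕ) : ℤ)) (θhat (n + i) - θ) *
            (F (C - y ((n + i + 1 : ℕ) : ℤ)) - s (n + i + 1))) := by
  have hB0 : 0 ≤ B := (norm_nonneg _).trans (hB θ hθ)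
  -- The two intervals are concentric, so their union is the larger one; the mean value theorem
  -- needs a single interval.
  have hf' : ∀ x ∈ Set.Icc (C - B * max M₁ M₂) (C + B * max M₁ M₂), fm ≤ f x ∧ f x ≤ fM := by
    intro x hx
    apply hf
    rcases max_choice M₁ M₂ with e | e <;> rw [e] at hx
    · exact Or.inr hx
    · exact Or.inl hx
  have hfM : 0 ≤ fM := by
    have := hf' C ⟨by nlinarith [le_max_left M₁ M₂], by nlinarith [le_max_left M₁ M₂]⟩
    linarith [this.1, this.2]
  have hh₁0 : 0 ≤ h₁ := le_trans (add_nonneg ENNReal.toReal_nonneg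
    (mul_nonneg hε.le (norm_nonneg _))) hh₁
  have hMpos : 0 ≤ powConst p ε := by unfold powConst; positivity
  set M := powConst p ε
  set sg := Real.sqrt (gBound p h) with hsg
  have hsg0 : 0 ≤ sg := Real.sqrt_nonneg _
  have hc' : 0 ≤ max (γ * M₂) ‖θ₀ - θ‖ := le_max_of_le_right (norm_nonneg _)
  -- The maximum covers the first step: `θ₀` may lie outside `Θ`, so the increment bound `γ * M₂` is
  -- available only from `k = 1` on.
  obtain ⟨K₁, hK₁0, hK₁⟩ := exists_bound_of_driven_recursion
    (Matrix.toEuclideanCLM (n := Fin p) (𝕜 := ℝ) (companion θ)) M h₁ M₂ (max (γ * M₂) ‖θ₀ - θ‖)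
    ‖lagVector p (fun j => y₀ j - y j) 0‖
    (norm_toEuclideanCLM_pow_le hp _ ε h₁ hε hh₁) hh₁0 hh₁lt hMpos hM₂pos.le hc'
  have h1h : 0 < 1 - h₁ := by linarith
  set L := M * M₂ / (1 - h₁) with hL
  have hL0 : 0 ≤ L := by positivity
  set K := fM * sg * (M₂ + 2 * M₁) * L with hKdef
  have hK0 : 0 ≤ K := by positivity
  have hex : ∀ k : ℕ, 1 ≤ k → ∀ x : Param p q, N * (δ * ‖x‖ ^ 2) ≤
      ∑ i ∈ Finset.range N, inner ℝ (regressor p q y u ((k + i : ℕ) : ℤ)) x ^ 2 := by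
    intro k hk x
    have h1 := hδ k hk x
    have hNR : (0 : ℝ) < N := by exact_mod_cast hN
    rw [one_div, ← div_eq_inv_mul, le_div_iff₀ hNR] at h1
    push_cast
    linarith
  obtain ⟨c, hc⟩ := exists_window_bound (fun k : ℕ => regressor p q y u (k : ℤ)) N γ fm δ K M₁
    (2 * B) (γ * M₂) (2 * γ * (fM * sg * (M₂ + 2 * M₁) * K₁ * (2 * B)) + (γ * M₂) ^ 2) hγ hfm hK0
    (by positivity) (by positivity) hM₁ hex
  have hmargin : margin fm fM δ (gBound p h) M M₁ M₂ h₁ = fm * δ - K := by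
    rw [margin, hKdef, hL, ← hsg]; ring
  refine ⟨c, fun s θhat yhat hθ0 hy0 ht hs hM₂ => ?_⟩
  have hxR : ∀ k, 1 ≤ k → ‖θhat k - θ‖ ≤ 2 * B := fun k hk =>
    (norm_sub_le _ _).trans (by linarith [hB _ (ht.mem hk), hB θ hθ])
  have hxd : ∀ k : ℕ, 1 ≤ k → ‖θhat (k + 1) - θhat k‖ ≤ γ * M₂ / ((k : ℝ) + 1) := fun k hk =>
    ht.norm_succ_sub_le hΘconv hγ hF01 hs hM₂ hk
  have herr : ∀ k : ℕ, ‖lagVector p (fun j => yhat j - y j) (k : ℤ)‖ ≤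
      L * ‖θhat k - θ‖ + K₁ / ((k : ℝ) + 1) := by
    refine hK₁ (fun k => lagVector p (fun j => yhat j - y j) (k : ℤ))
      (fun k => EuclideanSpace.single (⟨0, hp⟩ : Fin p)
        (inner ℝ (regressor p q yhat u (k : ℤ)) (θhat k - θ)))
      (fun k => ‖θhat k - θ‖) (le_of_eq ?_) (ht.lagVector_succ hp hy) (fun _ => norm_nonneg _)
      (fun k => ?_) (fun k => ?_)
    · congr 1
      ext i
      simp only [lagVector, Nat.cast_zero]
      rw [hy0 _ (by omega)]
    · rw [PiLp.norm_single]
      exact (norm_inner_le_norm _ _).trans (by gcongr; exact hM₂ (k + 1) (by omega))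
    · rcases k with _ | k
      · have h1 : ‖θhat 0 - θ‖ ≤ max (γ * M₂) ‖θ₀ - θ‖ := hθ0 ▸ le_max_right _ _
        simp only [Nat.cast_zero, zero_add, div_one]
        linarith [norm_nonneg (θhat 1 - θ)]
      · have h1 := norm_sub_norm_le (θhat (k + 1) - θ) (θhat (k + 1 + 1) - θ)
        rw [sub_sub_sub_cancel_right, norm_sub_rev (θhat (k + 1)) (θhat (k + 1 + 1))] at h1
        have h2 := hxd (k + 1) (by omega)
        have h3 : γ * M₂ / (((k + 1 : ℕ) : ℝ) + 1) ≤
            max (γ * M₂) ‖θ₀ - θ‖ / (((k + 1 : ℕ) : ℝ) + 1) := by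
          gcongr
          exact le_max_left _ _
        exact h1.trans (h2.trans h3)
  rw [hmargin]
  refine hc (fun k => θhat k - θ) (fun k => inner ℝ (regressor p q yhat u (k : ℤ))
    (θhat (k - 1) - θ) * (F (C - y (k : ℤ)) - s k)) hxR (fun k hk => ?_) (fun k hk => ?_)
  · have hkR : (0 : ℝ) < k := by exact_mod_cast hk
    rw [sub_sub_sub_cancel_right]
    refine (hxd k hk).trans ?_
    gcongr
    linarith
  · have hkR : (0 : ℝ) < k := by exact_mod_cast hk
    have hstep := ht.norm_sq_succ_le hΘconv hθ hγ hF01 hs hM₂ k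
    have hφ := hM₂ (k + 1) (by omega)
    have hψ := hM₁ (k + 1) (by omega)
    set φ := regressor p q yhat u ((k + 1 : ℕ) : ℤ) with hφdef
    set ψ := regressor p q y u ((k + 1 : ℕ) : ℤ) with hψdef
    set r := ‖lagVector p (fun j => yhat j - y j) (k : ℤ)‖ with hr
    have hinner : ∀ {w v : Param p q} {m : ℝ}, ‖w‖ ≤ m → m ≤ max M₁ M₂ → v ∈ Θ →
        |inner ℝ w v| ≤ B * max M₁ M₂ := by
      intro w v m hw hm hv
      refine (abs_real_inner_le_norm _ _).trans ?_
      rw [mul_comm B]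
      exact mul_le_mul (hw.trans hm) (hB v hv) (norm_nonneg _) (le_max_of_le_left hM₁pos.le)
    have hdiff : ∀ v ∈ Θ, |inner ℝ (φ - ψ) v| ≤ sg * r := by
      intro v hv
      have := abs_inner_regressor_sub_le hh0 (hΘsub hv) yhat y u ((k + 1 : ℕ) : ℤ)
      rwa [show ((k + 1 : ℕ) : ℤ) - 1 = (k : ℤ) by push_cast; ring] at this
    have hcorr := inner_mul_correction_le hF hfm hf' hφ hψ
      (hinner hφ (le_max_right _ _) (ht.mem hk)) (hinner hψ (le_max_left _ _) (ht.mem hk))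
      (hinner hψ (le_max_left _ _) hθ) (hdiff _ (ht.mem hk)) (hdiff _ hθ)
    rw [← hy.eq_inner (by omega)] at hcorr
    -- The part of `r` proportional to `‖θhat k - θ‖` reduces the contraction by `K`; the part
    -- `O(1/k)` becomes `O(1/k²)` after the step size.
    have hrem : fM * (sg * r) * (M₂ + 2 * M₁) * ‖θhat k - θ‖ ≤ K * ‖θhat k - θ‖ ^ 2 +
        fM * sg * (M₂ + 2 * M₁) * K₁ * (2 * B) / ((k : ℝ) + 1) := by
      calc fM * (sg * r) * (M₂ + 2 * M₁) * ‖θhat k - θ‖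
          ≤ fM * (sg * (L * ‖θhat k - θ‖ + K₁ / ((k : ℝ) + 1))) * (M₂ + 2 * M₁) *
              ‖θhat k - θ‖ := by gcongr; exact herr k
        _ = K * ‖θhat k - θ‖ ^ 2 +
            fM * sg * (M₂ + 2 * M₁) * K₁ * ‖θhat k - θ‖ / ((k : ℝ) + 1) := by rw [hKdef]; ring
        _ ≤ _ := by gcongr; exact hxR k hk
    set T := fM * sg * (M₂ + 2 * M₁) * K₁ * (2 * B) with hT
    have hT0 : 0 ≤ T := by positivity
    have hg : inner ℝ φ (θhat k - θ) * (F (C - inner ℝ φ (θhat k)) - s (k + 1)) ≤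
        (-fm * inner ℝ ψ (θhat k - θ) ^ 2 + K * ‖θhat k - θ‖ ^ 2 +
          inner ℝ φ (θhat k - θ) * (F (C - y ((k + 1 : ℕ) : ℤ)) - s (k + 1))) +
        T / ((k : ℝ) + 1) := by
      have : inner ℝ φ (θhat k - θ) * (F (C - inner ℝ φ (θhat k)) - s (k + 1)) =
          inner ℝ φ (θhat k - θ) * (F (C - inner ℝ φ (θhat k)) - F (C - y ((k + 1 : ℕ) : ℤ))) +
          inner ℝ φ (θhat k - θ) * (F (C - y ((k + 1 : ℕ) : ℤ)) - s (k + 1)) := by ring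
      rw [this]
      linarith
    have hg' := mul_le_mul_of_nonneg_left hg (by positivity : 0 ≤ 2 * γ / ((k : ℝ) + 1))
    have hsq : 2 * γ / ((k : ℝ) + 1) * (T / ((k : ℝ) + 1)) + (γ * M₂ / ((k : ℝ) + 1)) ^ 2 ≤
        (2 * γ * T + (γ * M₂) ^ 2) / (k : ℝ) ^ 2 := by
      have : 2 * γ / ((k : ℝ) + 1) * (T / ((k : ℝ) + 1)) + (γ * M₂ / ((k : ℝ) + 1)) ^ 2 =
          (2 * γ * T + (γ * M₂) ^ 2) / ((k : ℝ) + 1) ^ 2 := by field_simp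
      rw [this]
      gcongr
      linarith
    rw [mul_add] at hg'
    simp only [Nat.add_sub_cancel]
    linarith

end Trajectory

/-! ### Estimates and predictions as functions of past noise. -/

section Measurability

variable {p q : ℕ}

theorem measurable_binaryObs (C : ℝ) : Measurable (binaryObs C) :=
  Measurable.ite measurableSet_Iic measurable_const measurable_const

theorem binaryObs_mem (C z : ℝ) : 0 ≤ binaryObs C z ∧ binaryObs C z ≤ 1 := by
  unfold binaryObs; split_ifs <;> simp

theorem measurable_regressor {α : Type*} [MeasurableSpace α] (u : ℤ → ℝ) (yhat : ℤ → α → ℝ) (k : ℤ)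
    (h : ∀ j < k, Measurable (yhat j)) :
    Measurable fun ω => regressor p q (fun j => yhat j ω) u k := by
  refine (WithLp.measurable_toLp 2 _).comp (measurable_pi_iff.2 fun i => ?_)
  rcases i with i | j
  · exact h _ (by omega)
  · exact measurable_const

/-- The estimates and predictions up to time `n` are functions of the noise up to time `n`. -/
theorem measurable_trajectory {α : Type*} [MeasurableSpace α] {γ C : ℝ} {F : ℝ → ℝ}
    (hF : Measurable F) {Θ : Set (Param p q)} (hΘconv : Convex ℝ Θ) (hΘcomp : IsCompact Θ)
    {u y : ℤ → ℝ} {d : ℕ → α → ℝ} {θhat : ℕ → α → Param p q} {yhat : ℤ → α → ℝ} {θ₀ : Param p q}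
    {y₀ : ℤ → ℝ} (hθ0 : ∀ ω, θhat 0 ω = θ₀) (hy0 : ∀ k : ℤ, k ≤ 0 → ∀ ω, yhat k ω = y₀ k)
    (halg : ∀ ω, IsTrajectory γ C F Θ u (fun k => binaryObs C (y k + d k ω))
      (fun k => θhat k ω) (fun k => yhat k ω)) (n : ℕ)
    (hd : ∀ k, 1 ≤ k → k ≤ n → Measurable (d k)) :
    Measurable (θhat n) ∧ ∀ j : ℤ, j ≤ n → Measurable (yhat j) := by
  induction n with
  | zero =>
    refine ⟨?_, fun j hj => ?_⟩
    · rw [show θhat 0 = fun _ => θ₀ from funext hθ0]; exact measurable_const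
    · rw [show yhat j = fun _ => y₀ j from funext (hy0 j (by simpa using hj))]
      exact measurable_const
  | succ n ih =>
    obtain ⟨ihθ, ihy⟩ := ih fun k h1 h2 => hd k h1 (by omega)
    have hreg : Measurable fun ω => regressor p q (fun j => yhat j ω) u ((n + 1 : ℕ) : ℤ) :=
      measurable_regressor u yhat _ fun j hj => ihy j (by push_cast at hj; omega)
    have hθ : Measurable (θhat (n + 1)) := by
      rcases isEmpty_or_nonempty α with hα | ⟨⟨ω₀⟩⟩
      · exact measurable_of_empty _
      have hne : Θ.Nonempty := ⟨_, ((halg ω₀).estimate 1 le_rfl).1⟩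
      -- The trajectory is only specified by a minimization property. Uniqueness identifies it with
      -- a projection map, whose Lipschitz continuity gives measurability.
      choose P hP using exists_isProjection hΘcomp hne
      have hPcont : LipschitzWith 1 P := LipschitzWith.of_dist_le_mul fun x z => by
        simpa [dist_eq_norm] using (hP x).norm_sub_le hΘconv (hP z)
      have heq : θhat (n + 1) = fun ω => P (θhat n ω + ((γ / ((n + 1 : ℕ) : ℝ)) *
          (F (C - inner ℝ (regressor p q (fun j => yhat j ω) u ((n + 1 : ℕ) : ℤ)) (θhat n ω)) -
            binaryObs C (y ((n + 1 : ℕ) : ℤ) + d (n + 1) ω))) •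
          regressor p q (fun j => yhat j ω) u ((n + 1 : ℕ) : ℤ)) := by
        funext ω
        exact ((halg ω).estimate (n + 1) (by omega)).unique hΘconv (hP _)
      rw [heq]
      refine hPcont.continuous.measurable.comp (ihθ.add (Measurable.fun_smul ?_ hreg))
      refine measurable_const.mul (Measurable.sub ?_ ?_)
      · exact hF.comp (measurable_const.sub (hreg.inner ihθ))
      · exact (measurable_binaryObs C).comp
          (measurable_const.add (hd (n + 1) (by omega) le_rfl))
    refine ⟨hθ, fun j hj => ?_⟩
    rcases hj.lt_or_eq with hlt | rfl
    · exact ihy j (by push_cast at hlt; omega)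
    · rw [show yhat ((n + 1 : ℕ) : ℤ) = fun ω => inner ℝ
        (regressor p q (fun j => yhat j ω) u ((n + 1 : ℕ) : ℤ)) (θhat (n + 1) ω) from
        funext fun ω => (halg ω).prediction (n + 1) (by omega)]
      exact hreg.inner hθ

end Measurability

/-! ### Independence and centering of the quantization error. -/

section Noise

variable {Ω : Type*} [MeasurableSpace Ω] {μ : Measure Ω}
  {d : ℕ → Ω → ℝ} {ν : Measure ℝ} {f : ℝ → ℝ}

/-- The noise `d₁, …, d_n`. -/
def noiseVector {Ω : Type*} (d : ℕ → Ω → ℝ) (n : ℕ) (ω : Ω) (i : Finset.range n) : ℝ := d (i + 1) ω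

theorem measurable_noise_comap {Ω : Type*} (d : ℕ → Ω → ℝ) (n : ℕ) {k : ℕ} (h1 : 1 ≤ k) (hk : k ≤ n) :
    Measurable[MeasurableSpace.pi.comap (noiseVector d n)] (d k) := by
  have h2 : d k = (fun x : Finset.range n → ℝ => x ⟨k - 1, by simp; omega⟩) ∘ noiseVector d n := by
    funext ω
    simp [noiseVector, Nat.sub_add_cancel h1]
  rw [h2]
  exact (measurable_pi_apply _).comp (comap_measurable _)

theorem IsNoise.aemeasurable_noiseVector (hd : IsNoise μ d ν f) (n : ℕ) :
    AEMeasurable (noiseVector d n) μ :=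
  aemeasurable_pi_lambda _ fun i => (hd.hasLaw (i + 1) (by omega)).aemeasurable

theorem IsNoise.indepFun_noiseVector (hd : IsNoise μ d ν f) (n : ℕ) :
    IndepFun (noiseVector d n) (d (n + 1)) μ := by
  have h := hd.indep.indepFun_finset₀ (Finset.range n) {n} (by simp)
    fun i => (hd.hasLaw (i + 1) (by omega)).aemeasurable
  exact h.comp measurable_id (measurable_pi_apply (⟨n, by simp⟩ : ({n} : Finset ℕ)))

/-- The noise is only almost everywhere measurable, so the σ-algebra it generates need not lie
inside the ambient one. Factoring `X` through the noise vector circumvents this. -/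
theorem IsNoise.aemeasurable_of_comap (hd : IsNoise μ d ν f) (n : ℕ) {Z : Type*} [Nonempty Z]
    [MeasurableSpace Z] [StandardBorelSpace Z] {X : Ω → Z}
    (hX : Measurable[MeasurableSpace.pi.comap (noiseVector d n)] X) : AEMeasurable X μ := by
  obtain ⟨g, hg, rfl⟩ := hX.exists_eq_measurable_comp
  exact hg.comp_aemeasurable (hd.aemeasurable_noiseVector n)

/-- The quantization error is centered and independent of the past. -/
theorem IsNoise.integral_mul_obs_eq_zero [IsProbabilityMeasure μ] (hd : IsNoise μ d ν f) (n : ℕ) {X : Ω → ℝ}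
    (hX : Measurable[MeasurableSpace.pi.comap (noiseVector d n)] X) (C a : ℝ) :
    ∫ ω, X ω * (cdf ν (C - a) - binaryObs C (a + d (n + 1) ω)) ∂μ = 0 := by
  have hlaw := hd.hasLaw (n + 1) (by omega)
  have : IsProbabilityMeasure ν := hlaw.isProbabilityMeasure_iff.1 ‹_›
  obtain ⟨g, hg, rfl⟩ := hX.exists_eq_measurable_comp
  have hψ : Measurable fun t : ℝ => cdf ν (C - a) - binaryObs C (a + t) :=
    measurable_const.sub ((measurable_binaryObs C).comp (measurable_const.add measurable_id))
  have h1 := (hd.indepFun_noiseVector n).integral_comp_mul_comp (𝕜 := ℝ)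
    (hd.aemeasurable_noiseVector n) hlaw.aemeasurable hg.aestronglyMeasurable
    hψ.aestronglyMeasurable
  -- The observation is the indicator of `d (n + 1) ≤ C - a`, whose mean is the distribution
  -- function at `C - a`.
  have h2 : ∫ ω, (cdf ν (C - a) - binaryObs C (a + d (n + 1) ω)) ∂μ = 0 := by
    have h3 : ∀ t, binaryObs C (a + t) = (Set.Iic (C - a)).indicator 1 t := by
      intro t
      simp only [binaryObs, Set.indicator, Set.mem_Iic, le_sub_iff_add_le', Pi.one_apply]
    have h4 := integral_map hlaw.aemeasurable hψ.aestronglyMeasurable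
    rw [← h4, hlaw.map_eq]
    simp only [h3]
    rw [integral_sub (integrable_const _) ((integrable_const 1).indicator measurableSet_Iic),
      integral_indicator_one measurableSet_Iic, cdf_eq_real]
    simp
  refine Eq.trans h1 ?_
  rw [show ((fun t : ℝ => cdf ν (C - a) - binaryObs C (a + t)) ∘ d (n + 1)) =
    fun ω => cdf ν (C - a) - binaryObs C (a + d (n + 1) ω) from rfl, h2, mul_zero]

theorem IsNoise.density_nonneg (hd : IsNoise μ d ν f) (x : ℝ) : 0 ≤ f x := by
  rw [← (hd.hasDerivAt_cdf x).deriv]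
  exact (monotone_cdf ν).deriv_nonneg

end Noise

end ARMA

end

/-! ### Passage to expectations and the rate. -/

theorem theorem2
    -- the model: orders, parameter, input, output, threshold
    (p q : ℕ) (hp : 0 < p) (hq : 0 < q)
    (θ : ARMA.Param p q)
    (hap : ∀ i : Fin p, (i : ℕ) + 1 = p → θ (Sum.inl i) ≠ 0)
    (hcoprime : ∀ z : ℂ, ¬ (Polynomial.aeval z (ARMA.arPoly θ) = 0 ∧
      Polynomial.aeval z (ARMA.inPoly θ) = 0))
    (u y : ℤ → ℝ) (hy : ARMA.IsOutput θ u y) (C : ℝ)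
    -- causality, parameter set
    (h : ℝ) (hh0 : 0 < h) (hh1 : h < 1)
    (hθcausal : θ ∈ ARMA.causalSet p q h)
    (Θ : Set (ARMA.Param p q)) (hΘconv : Convex ℝ Θ) (hΘcomp : IsCompact Θ)
    (hΘsub : Θ ⊆ ARMA.causalSet p q h) (hθ : θ ∈ Θ)
    (B : ℝ) (hB : IsLUB ((fun v : ARMA.Param p q => ‖v‖) '' Θ) B)
    -- noise
    {Ω : Type*} [MeasurableSpace Ω] (μ : Measure Ω) [IsProbabilityMeasure μ]
    (d : ℕ → Ω → ℝ) (ν : Measure ℝ) (f : ℝ → ℝ) (hd : ARMA.IsNoise μ d ν f)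
    -- input
    (hu : ARMA.PersistentInput p q u)
    -- the algorithm, started from deterministic initial values
    (γ : ℝ) (θhat : ℕ → Ω → ARMA.Param p q) (yhat : ℤ → Ω → ℝ)
    (θ₀ : ARMA.Param p q) (y₀ : ℤ → ℝ)
    (hθhat₀ : ∀ ω, θhat 0 ω = θ₀) (hyhat₀ : ∀ k : ℤ, k ≤ 0 → ∀ ω, yhat k ω = y₀ k)
    (halg : ∀ ω, ARMA.IsTrajectory γ C (fun t => cdf ν t) Θ u
      (fun k => ARMA.binaryObs C (y k + d k ω)) (fun k => θhat k ω) (fun k => yhat k ω))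
    -- the constants in the condition on the step size
    (ε h₁ : ℝ) (hε : 0 < ε)
    (hh₁ : ARMA.specRadius (ARMA.companion θ) + ε * ARMA.opNorm (ARMA.companion θ) ≤ h₁)
    (hh₁lt : h₁ < 1)
    (M₁ M₂ : ℝ) (hM₁pos : 0 < M₁) (hM₂pos : 0 < M₂)
    (hM₁ : ∀ k : ℕ, 1 ≤ k → ‖ARMA.regressor p q y u k‖ ≤ M₁)
    (hM₂ : ∀ k : ℕ, 1 ≤ k → ∀ᵐ ω ∂μ, ‖ARMA.regressor p q (fun j => yhat j ω) u k‖ ≤ M₂)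
    (N : ℕ) (hN : 0 < N) (δ : ℝ) (hδpos : 0 < δ)
    (hδ : ARMA.Excites (ARMA.regressor p q y u) N δ)
    (fm fM : ℝ)
    (hfm : IsLeast (f '' (Set.Icc (C - B * M₂) (C + B * M₂) ∪
      Set.Icc (C - B * M₁) (C + B * M₁))) fm)
    (hfM : IsGreatest (f '' (Set.Icc (C - B * M₂) (C + B * M₂) ∪
      Set.Icc (C - B * M₁) (C + B * M₁))) fM)
    -- the condition on the constants and on the step size
    (hmargin : 0 < ARMA.margin fm fM δ (ARMA.gBound p h) (ARMA.powConst p ε) M₁ M₂ h₁)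
    (hγ : 1 / (2 * ARMA.margin fm fM δ (ARMA.gBound p h) (ARMA.powConst p ε) M₁ M₂ h₁) < γ) :
    (∀ k : ℕ, Integrable (fun ω => ‖θhat k ω - θ‖ ^ 2) μ) ∧
      (fun k : ℕ => ∫ ω, ‖θhat k ω - θ‖ ^ 2 ∂μ) =O[atTop] (fun k : ℕ => 1 / (k : ℝ)) := by

  have hBle : ∀ v ∈ Θ, ‖v‖ ≤ B := fun v hv => hB.1 ⟨v, hv, rfl⟩
  set D := ARMA.margin fm fM δ (ARMA.gBound p h) (ARMA.powConst p ε) M₁ M₂ h₁ with hD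
  have hγ0 : 0 < γ := lt_trans (by positivity) hγ
  have hα : 1 < 2 * γ * D := by
    rw [div_lt_iff₀ (by positivity)] at hγ
    linarith
  have hF01 : ∀ x, 0 ≤ cdf ν x ∧ cdf ν x ≤ 1 := fun x => ⟨cdf_nonneg ν x, cdf_le_one ν x⟩
  have hfm0 : 0 ≤ fm := by
    obtain ⟨x, -, rfl⟩ := hfm.1
    exact hd.density_nonneg x
  obtain ⟨c, hc⟩ := ARMA.exists_trajectory_bound (F := fun t => cdf ν t) hp hy hh0 hΘconv hΘsub hθ
    hBle hd.hasDerivAt_cdf hF01 hγ0.le θ₀ y₀ hε hh₁ hh₁lt hM₁pos hM₂pos hM₁ hN hδ hfm0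
    (fun x hx => ⟨hfm.2 ⟨x, hx, rfl⟩, hfM.2 ⟨x, hx, rfl⟩⟩)
  have hmeas : ∀ n : ℕ, Measurable[MeasurableSpace.pi.comap (ARMA.noiseVector d n)] (θhat n) ∧
      Measurable[MeasurableSpace.pi.comap (ARMA.noiseVector d n)]
        fun ω => ARMA.regressor p q (fun j => yhat j ω) u ((n + 1 : ℕ) : ℤ) := by
    intro n
    -- This shadows the ambient σ-algebra by that of `d₁, …, d_n`. The regressor at time `n + 1` is
    -- measurable for it because it contains predictions only up to time `n`.
    let _ : MeasurableSpace Ω := MeasurableSpace.pi.comap (ARMA.noiseVector d n)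
    have h1 := ARMA.measurable_trajectory (monotone_cdf ν).measurable hΘconv hΘcomp hθhat₀ hyhat₀
      halg n fun k h1 h2 => ARMA.measurable_noise_comap d n h1 h2
    exact ⟨h1.1, ARMA.measurable_regressor u yhat _ fun j hj => h1.2 j (by push_cast at hj; omega)⟩
  have hX : ∀ n : ℕ, Measurable[MeasurableSpace.pi.comap (ARMA.noiseVector d n)]
      fun ω => inner ℝ (ARMA.regressor p q (fun j => yhat j ω) u ((n + 1 : ℕ) : ℤ))
        (θhat n ω - θ) := by
    intro n
    obtain ⟨h1, h2⟩ := hmeas n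
    let _ : MeasurableSpace Ω := MeasurableSpace.pi.comap (ARMA.noiseVector d n)
    exact h2.inner (h1.sub_const θ)
  set R := max (2 * B) ‖θ₀ - θ‖ with hR
  have hbound : ∀ n ω, ‖θhat n ω - θ‖ ≤ R := by
    intro n ω
    rcases n with _ | n
    · rw [hθhat₀]; exact le_max_right _ _
    · refine le_max_of_le_left ((norm_sub_le _ _).trans ?_)
      linarith [hBle _ ((halg ω).mem (k := n + 1) (by omega)), hBle θ hθ]
  have hR0 : 0 ≤ R := le_max_of_le_right (norm_nonneg _)
  have hint : ∀ k : ℕ, Integrable (fun ω => ‖θhat k ω - θ‖ ^ 2) μ := by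
    intro k
    have h1 := hd.aemeasurable_of_comap k (hmeas k).1
    refine Integrable.of_bound (((h1.sub_const θ).norm.pow_const 2).aestronglyMeasurable) (R ^ 2)
      (Eventually.of_forall fun ω => ?_)
    rw [Real.norm_of_nonneg (by positivity)]
    exact pow_le_pow_left₀ (norm_nonneg _) (hbound k ω) 2
  refine ⟨hint, ?_⟩
  have hreg : ∀ᵐ ω ∂μ, ∀ k : ℕ, 1 ≤ k → ‖ARMA.regressor p q (fun j => yhat j ω) u k‖ ≤ M₂ := by
    rw [ae_all_iff]
    intro k
    by_cases hk : 1 ≤ k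
    · filter_upwards [hM₂ k hk] with ω hω _ using hω
    · exact Eventually.of_forall fun ω h => absurd h hk
  have hζint : ∀ k : ℕ, Integrable (fun ω =>
      inner ℝ (ARMA.regressor p q (fun j => yhat j ω) u ((k + 1 : ℕ) : ℤ)) (θhat k ω - θ) *
        (cdf ν (C - y ((k + 1 : ℕ) : ℤ)) -
          ARMA.binaryObs C (y ((k + 1 : ℕ) : ℤ) + d (k + 1) ω))) μ := by
    intro k
    have h1 := hd.aemeasurable_of_comap k (hX k)
    have h2 : AEMeasurable (fun ω => cdf ν (C - y ((k + 1 : ℕ) : ℤ)) -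
        ARMA.binaryObs C (y ((k + 1 : ℕ) : ℤ) + d (k + 1) ω)) μ :=
      ((ARMA.measurable_binaryObs C).comp_aemeasurable
        ((hd.hasLaw (k + 1) (by omega)).aemeasurable.const_add _)).const_sub _
    refine Integrable.of_bound (h1.mul h2).aestronglyMeasurable (M₂ * R * 1) ?_
    filter_upwards [hreg] with ω hω
    rw [norm_mul]
    refine mul_le_mul ((norm_inner_le_norm _ _).trans ?_)
      (ARMA.abs_sub_le_one (hF01 _) (ARMA.binaryObs_mem _ _)) (norm_nonneg _) (by positivity)
    exact mul_le_mul (hω (k + 1) (by omega)) (hbound k ω) (norm_nonneg _) hM₂pos.le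
  refine ARMA.isBigO_of_chung_recursion _ N hN (2 * γ * D) c (R ^ 2) hα
    (fun n => integral_nonneg fun ω => by positivity) (fun n => ?_) (fun n hn => ?_)
  · have h1 : ∫ ω, ‖θhat n ω - θ‖ ^ 2 ∂μ ≤ ∫ _, R ^ 2 ∂μ :=
      integral_mono (hint n) (integrable_const _) fun ω =>
        pow_le_pow_left₀ (norm_nonneg _) (hbound n ω) 2
    simpa using h1
  · have hsumint : Integrable (fun ω => ∑ i ∈ Finset.range N, 2 * γ / (((n + i : ℕ) : ℝ) + 1) *
        (inner ℝ (ARMA.regressor p q (fun j => yhat j ω) u ((n + i + 1 : ℕ) : ℤ))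
          (θhat (n + i) ω - θ) * (cdf ν (C - y ((n + i + 1 : ℕ) : ℤ)) -
            ARMA.binaryObs C (y ((n + i + 1 : ℕ) : ℤ) + d (n + i + 1) ω)))) μ :=
      integrable_finsetSum _ fun i _ => (hζint (n + i)).const_mul _
    have hlin := ((hint n).const_mul (1 - 2 * γ * D * N / n)).add
      (integrable_const (c / (n : ℝ) ^ 2))
    -- The pathwise inequality holds with one constant `c` for almost every `ω`, so it can be
    -- integrated; the noise sum then has mean zero term by term.
    have hmono := integral_mono_ae (hint (n + N)) (hlin.add hsumint) (by
      filter_upwards [hreg] with ω hω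
      exact hc (fun k => ARMA.binaryObs C (y k + d k ω)) (fun k => θhat k ω) (fun k => yhat k ω)
        (hθhat₀ ω) (fun k hk => hyhat₀ k hk ω) (halg ω) (fun k => ARMA.binaryObs_mem _ _) hω n hn)
    refine hmono.trans (le_of_eq ?_)
    rw [integral_add' hlin hsumint, integral_add' ((hint n).const_mul _) (integrable_const _),
      integral_const_mul, integral_const,
      integral_finsetSum _ fun i _ => (hζint (n + i)).const_mul _, Finset.sum_eq_zero]
    · simp
    · intro i _
      rw [integral_const_mul, hd.integral_mul_obs_eq_zero (n + i) (hX (n + i)), mul_zero]
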